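/- A real arrangement $\mathcal A$ is a finite set of affine hyperplanes in $\mathbb R^d$, $d\ge 1$. Its intersection poset $L_{\mathcal A}$ is the set of all nonempty intersections of subfamilies of $\mathcal A$ (including the empty intersection $\hat 0=\mathbb R^d$), ordered by reverse inclusion, and its characteristic polynomial is $\chi_{\mathcal A}(q)=\sum_{x\in L_{\mathcal A}}\mu(\hat 0,x)\,q^{\dim x}$, where $\mu$ is the Möbius function of $L_{\mathcal A}$. The semicone $\mathrm{sc}(\mathcal A)$ is the arrangement of the linear hyperplanes $\{(x,y)\in\mathbb R^{d}\times\mathbb R:\alpha\cdot x=cy\}$, one for each hyperplane $\{x:\alpha\cdot x=c\}$ of $\mathcal A$; its intersection lattice $L_{\mathrm{sc}(\mathcal A)}$ is the lattice of flats of the matroid $M_{\mathcal A}$ of the vectors $(\alpha,-c)$. For a point $p$ on no hyperplane of $\mathcal A$, the valid order arrangement $\mathrm{vo}(\mathcal A,p)$ consists of the affine spans of $p$ and $H\cap H'$ for non-parallel $H,H'\in\mathcal A$, and of the hyperplanes through $p$ parallel to $H$ and $H'$ for distinct parallel $H,H'\in\mathcal A$. A valid ordering of $\mathcal A$ with respect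 to $p$ is the order in which the hyperplanes of $\mathcal A$ are met along a directed line through $p$ which is parallel to no hyperplane of $\mathcal A$ and meets no two distinct ones in the same point, when one leaves $p$ in the direction of the line, passes through infinity and returns to $p$ from the opposite side (the order of line shellings). Let $v(\mathcal A,p)$ be the number of valid orderings. To every arrangement $\mathcal A$ in $\mathbb R^d$, for every $d$, one can associate a nonzero real polynomial $g_{\mathcal A}$ in $d$ variables such that the following holds, where a point $p\in\mathbb R^d$ is called generic for $\mathcal A$ if it lies on no hyperplane of $\mathcal A$ and $g_{\mathcal A}(p)\neq 0$. Let $\mathcal A$ and $\mathcal B$ be arrangements in $\mathbb R^d$ and $\mathbb R^e$ ($d,e\ge 1$) with $L_{\mathcal A}\cong L_{\mathcal B}$ or $L_{\mathrm{sc}(\mathcal A)}\cong L_{\mathrm{sc}(\mathcal B)}$ as posets, and let $p$ be generic for $\mathcal A$ and $q_0$ generic for $\mathcal B$. Then $$q^{e}\,\chi_{\mathrm{vo}(\mathcal A,p)}(q)=q^{d}\,\chi_{\mathrm{vo}(\mathcal B,q_0)}(q),\qquad v(\mathcal A,p)=v(\mathcal B,q_0);$$ in particular $\chi_{\mathrm{vo}(\mathcal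 A,p)}=\chi_{\mathrm{vo}(\mathcal B,q_0)}$ if $d=e$. Moreover, $v(\mathcal A,p)=v(\mathcal A,p')$ for all points $p,p'$ generic for $\mathcal A$, whichever regions of $\mathcal A$ they lie in. -/

import Mathlib

open Polynomial

noncomputable section

namespace HyperplaneArrangement

variable {E : Type*} [AddCommGroup E] [Module ℝ E]

/-- An affine hyperplane: a nonempty affine subspace of codimension one. -/
def IsHyperplane (H : AffineSubspace ℝ E) : Prop :=
  (H : Set E).Nonempty ∧ Module.finrank ℝ H.direction + 1 = Module.finrank ℝ E

/-- A finite set of affine subspaces is an arrangement if all its members are hyperplanes. -/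
def IsArrangement (A : Finset (AffineSubspace ℝ E)) : Prop :=
  ∀ H ∈ A, IsHyperplane H

open Classical in
/-- The nonempty intersections of subfamilies of `A`; the empty subfamily gives the whole
space. -/
def intersections (A : Finset (AffineSubspace ℝ E)) : Finset (AffineSubspace ℝ E) :=
  (A.powerset.image fun S => S.inf id).filter fun X => (X : Set E).Nonempty

/-- The intersection poset of `A`: its nonempty intersections, ordered by *reverse* inclusion. -/
abbrev IntersectionPoset (A : Finset (AffineSubspace ℝ E)) : Type _ :=
  {X : AffineSubspace ℝ E // X ∈ intersections A}ᵒᵈ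

theorem top_mem_intersections (A : Finset (AffineSubspace ℝ E)) :
    (⊤ : AffineSubspace ℝ E) ∈ intersections A := by
  classical
  refine Finset.mem_filter.2 ⟨Finset.mem_image.2 ⟨∅, by simp, by simp⟩, ?_⟩
  exact ⟨0, AffineSubspace.mem_top ℝ E 0⟩

/-- The least element of the intersection poset: the whole space. -/
def whole (A : Finset (AffineSubspace ℝ E)) : IntersectionPoset A :=
  OrderDual.toDual ⟨⊤, top_mem_intersections A⟩

open Classical in
/-- The Möbius function `μ(x, y)` of the intersection poset. -/
def moebius (A : Finset (AffineSubspace ℝ E)) (x y : IntersectionPoset A) : ℤ :=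
  letI : LocallyFiniteOrder (IntersectionPoset A) := Fintype.toLocallyFiniteOrder
  IncidenceAlgebra.mu ℤ x y

/-- The characteristic polynomial `χ_A(X) = ∑ x, μ(0̂, x) X ^ dim x`, the sum over the
intersection poset. -/
def charPoly (A : Finset (AffineSubspace ℝ E)) : ℤ[X] :=
  ∑ x : IntersectionPoset A,
    C (moebius A (whole A) x) *
      X ^ Module.finrank ℝ (OrderDual.ofDual x).1.direction

/-- The linear hyperplane `{(x, y) | α x = c y}` of `E × ℝ`, where `H = {x | α x = c}`; it is the
linear span of `H × {1}`. -/
def homogenize (H : AffineSubspace ℝ E) : AffineSubspace ℝ (E × ℝ) :=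
  (Submodule.span ℝ ((fun x : E => (x, (1 : ℝ))) '' (H : Set E))).toAffineSubspace

open Classical in
/-- The semicone of `A`. -/
def semicone (A : Finset (AffineSubspace ℝ E)) : Finset (AffineSubspace ℝ (E × ℝ)) :=
  A.image homogenize

/-- The member of the valid order arrangement coming from `H` and `H'`: the hyperplane through `p`
parallel to both if they are parallel, and the affine span of `p` and `H ∩ H'` otherwise. -/
def voHyperplane (p : E) (H H' : AffineSubspace ℝ E) : AffineSubspace ℝ E :=
  open Classical in
  if H.Parallel H' then AffineSubspace.mk' p H.direction
  else affineSpan ℝ (insert p ((H : Set E) ∩ (H' : Set E)))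

open Classical in
/-- The valid order arrangement `vo(A, p)`. -/
def vo (A : Finset (AffineSubspace ℝ E)) (p : E) : Finset (AffineSubspace ℝ E) :=
  ((A ×ˢ A).filter fun P => P.1 ≠ P.2).image fun P => voHyperplane p P.1 P.2

/-- The point `p + s • u` is reached before `p + t • u` when one leaves `p` in the direction `u`,
passes through infinity and returns to `p` from the opposite side. -/
def ReachedBefore (s t : ℝ) : Prop :=
  (0 < s ∧ s < t) ∨ (0 < s ∧ t < 0) ∨ (s < t ∧ t < 0)

/-- `u` is the direction of a directed line through `p` that is parallel to no hyperplane of `A`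
and meets no two distinct hyperplanes of `A` in the same point. -/
def IsAdmissibleDirection (A : Finset (AffineSubspace ℝ E)) (p u : E) : Prop :=
  u ≠ 0 ∧ (∀ H ∈ A, u ∉ H.direction) ∧
    ∀ H ∈ A, ∀ H' ∈ A, H ≠ H' → ∀ t : ℝ, ¬ (p + t • u ∈ H ∧ p + t • u ∈ H')

/-- `l` lists the hyperplanes of `A`, each once, in the order in which they are met by some
admissible directed line through `p`. -/
def IsValidOrdering (A : Finset (AffineSubspace ℝ E)) (p : E)
    (l : List (AffineSubspace ℝ E)) : Prop :=
  l.Nodup ∧ (∀ H, H ∈ l ↔ H ∈ A) ∧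
    ∃ u : E, IsAdmissibleDirection A p u ∧
      l.Pairwise fun H H' => ∃ s t : ℝ, p + s • u ∈ H ∧ p + t • u ∈ H' ∧ ReachedBefore s t

/-- The number of valid orderings of `A` with respect to `p`. -/
def numValidOrderings (A : Finset (AffineSubspace ℝ E)) (p : E) : ℕ :=
  {l : List (AffineSubspace ℝ E) | IsValidOrdering A p l}.ncard

end HyperplaneArrangement

end

/-!
Fix a point `p` on no hyperplane of `A` and write each hyperplane as `H = {x | β_H (x - p) = 1}`
(`gauge`). The line `p + ℝ u` meets `H` at the parameter `1 / β_H u`, and passing through infinity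
means meeting the hyperplanes in the order of decreasing `β_H u`. The hyperplanes of `vo(A, p)` are
therefore the `p + ker (β_H - β_H')` (`vo_eq_centralArrangement`), in the parallel and in the
intersecting case alike, and valid orderings correspond to the sign patterns of the functionals
`β_H - β_H'` (`numValidOrderings_eq_ncard_signPatterns`). Both invariants depend only on which sets
of these functionals are linearly independent. For the characteristic polynomial this holds because
the intersection poset is the lattice of flats (`charPoly_centralArrangement_congr`), and for the
number of sign patterns because it satisfies the deletion-restriction recursion
(`ncard_signPatterns_congr`).

It remains to find the matroid of the `β_H - β_H'`. With the equation `φ_H (x, y) = α x - c y` of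
`H`, it is the matroid of the vectors `φ_H' (p, 1) φ_H - φ_H (p, 1) φ_H'`, the intersections of the
planes spanned by `φ_H` and `φ_H'` with the hyperplane of functionals vanishing at `(p, 1)`. By
Lovász's theorem, for generic `p` this is the Dilworth truncation of the matroid of the `φ_H`: a set
`T` of pairs is independent if and only if every nonempty `S ⊆ T` touches equations of rank at least
`#S + 1`. Necessity is a dimension count. For sufficiency one point `p` per `T` is enough, since
independence at `p` is implied by the nonvanishing of a determinant that is a polynomial in `p`.
Such a point is found by induction on `T`, passing to the quotient by a general vector of one of the
planes (`exists_dual_linearIndepOn_section`).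

Finally, the matroid of the `φ_H` can be read off from either poset. The hyperplanes are the atoms.
Having a common point and independent normals means being bounded above and irredundant
(`irredundant_iff`). For the semicone this is independence of the `φ_H`. For `A` itself, the sets of
independent `φ_H` are these sets and those sets without a common point that become such a set when
one hyperplane is removed (`linearIndepOn_iff_of_equations`).
-/

namespace HyperplaneArrangement

open Module Submodule


/-! ### Sections of planes by a hyperplane -/

section PlaneSection

variable {K : Type*} [Field K]

/-- A line `{a + y b}` that does not lie in `D` together with its direction meets `D` at most
once. -/
theorem finite_setOf_add_smul_mem {W : Type*} [AddCommGroup W] [Module K W] {a b : W}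
    {D : Submodule K W} (h : ¬ (a ∈ D ∧ b ∈ D)) : {y : K | a + y • b ∈ D}.Finite := by
  refine Set.Subsingleton.finite fun y hy z hz => ?_
  by_contra hyz
  have hb : b ∈ D := by
    have h1 := D.sub_mem hy hz
    rw [add_sub_add_left_eq_sub, ← sub_smul] at h1
    exact (D.smul_mem_iff (sub_ne_zero.2 hyz)).1 h1
  exact h ⟨(D.add_mem_iff_left (D.smul_mem y hb)).1 hy, hb⟩

theorem finrank_map_add_finrank_inf_ker {W W' : Type*} [AddCommGroup W] [Module K W]
    [AddCommGroup W'] [Module K W'] [FiniteDimensional K W] (f : W →ₗ[K] W')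
    (U : Submodule K W) : finrank K (U.map f) + finrank K ↥(U ⊓ f.ker) = finrank K U := by
  have h := (f.domRestrict U).finrank_range_add_finrank_ker
  rw [LinearMap.range_domRestrict, LinearMap.ker_domRestrict] at h
  rw [← h, ← Submodule.map_comap_subtype, Submodule.finrank_map_subtype_eq]

theorem finrank_le_finrank_map_mkQ {W : Type*} [AddCommGroup W] [Module K W]
    [FiniteDimensional K W] (h : W) (U : Submodule K W) :
    finrank K U ≤ finrank K (U.map (K ∙ h).mkQ) + 1 ∧
      (h ∉ U → finrank K U ≤ finrank K (U.map (K ∙ h).mkQ)) := by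
  have h1 := finrank_map_add_finrank_inf_ker (K ∙ h).mkQ U
  rw [Submodule.ker_mkQ] at h1
  have h2 : finrank K ↥(U ⊓ K ∙ h) ≤ 1 :=
    (Submodule.finrank_mono inf_le_right).trans (by simpa using finrank_span_le_card (R := K) {h})
  refine ⟨by omega, fun hU => ?_⟩
  have h3 : U ⊓ K ∙ h = ⊥ := by
    refine (Submodule.eq_bot_iff _).2 fun x hx => ?_
    obtain ⟨c, rfl⟩ := Submodule.mem_span_singleton.1 hx.2
    by_cases hc : c = 0
    · simp [hc]
    · exact absurd ((U.smul_mem_iff hc).1 hx.1) hU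
  rw [h3, finrank_bot] at h1
  exact h1.ge

/-- Lovász's theorem on sections by a hyperplane, the existence part: if every nonempty
set `S` of the planes `span {a e, b e}` spans dimension at least `#S + 1`, then there is a
hyperplane `ker P` that meets these planes in linearly independent lines, and it can be chosen to
avoid finitely many given nonzero vectors. The proof inducts on the number of planes, passing to
the quotient by a general vector of one of them. -/
theorem exists_dual_linearIndepOn_section [Infinite K] {ι : Type*} (T : Finset ι) :
    ∀ {W : Type*} [AddCommGroup W] [Module K W] [FiniteDimensional K W] (a b : ι → W)
      (Z : Set W), Z.Finite → (∀ z ∈ Z, z ≠ 0) →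
      (∀ S : Finset ι, S ⊆ T → S.Nonempty →
        S.card + 1 ≤ finrank K (span K (a '' S ∪ b '' S))) →
      ∃ P : Dual K W, (∀ z ∈ Z, P z ≠ 0) ∧
        LinearIndepOn K (fun e => P (b e) • a e - P (a e) • b e) (T : Set ι) := by
  classical
  induction T using Finset.induction_on with
  | empty =>
    intro W _ _ _ a b Z hZ hZ0 _
    have := hZ.to_subtype
    obtain ⟨P, hP⟩ := Module.exists_dual_forall_apply_ne_zero (K := K) (fun z : Z => (z : W))
      fun z => hZ0 z z.2
    exact ⟨P, fun z hz => hP ⟨z, hz⟩, by simp⟩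
  | insert e T he ih =>
    intro W _ _ _ a b Z hZ hZ0 hT
    set U : Finset ι → Submodule K W := fun S => span K (a '' S ∪ b '' S) with hU
    -- the plane of `e` is not contained in a line
    have hline : ∀ z : W, ¬ (a e ∈ K ∙ z ∧ b e ∈ K ∙ z) := by
      rintro z ⟨h1, h2⟩
      have h3 := hT {e} (by simp) (by simp)
      have h4 : span K (a '' ({e} : Finset ι) ∪ b '' ({e} : Finset ι)) ≤ K ∙ z := by
        rw [span_le]
        rintro _ (⟨x, hx, rfl⟩ | ⟨x, hx, rfl⟩) <;> simp at hx <;> subst hx <;> assumption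
      have h5 : finrank K (K ∙ z) ≤ 1 := by simpa using finrank_span_le_card (R := K) {z}
      have h6 := Submodule.finrank_mono h4
      simp only [Finset.card_singleton] at h3
      omega
    -- nor in the span of a tight set of planes
    have htight : ∀ S ∈ T.powerset, finrank K (U S) ≤ S.card + 1 →
        ¬ (a e ∈ U S ∧ b e ∈ U S) := by
      rintro S hS h1 ⟨h2, h3⟩
      rw [Finset.mem_powerset] at hS
      have h4 := hT (insert e S) (Finset.insert_subset_insert e hS) (by simp)
      rw [Finset.card_insert_of_notMem fun h => he (hS h)] at h4
      have h5 : span K (a '' (insert e S : Finset ι) ∪ b '' (insert e S : Finset ι)) ≤ U S := by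
        rw [span_le, Finset.coe_insert, Set.image_insert_eq, Set.image_insert_eq]
        rintro _ ((rfl | h) | (rfl | h))
        · exact h2
        · exact subset_span (Or.inl h)
        · exact h3
        · exact subset_span (Or.inr h)
      have := Submodule.finrank_mono h5
      omega
    have hbad : ((⋃ z ∈ Z, {y : K | a e + y • b e ∈ K ∙ z}) ∪
        ⋃ S ∈ T.powerset.filter fun S => finrank K (U S) ≤ S.card + 1,
          {y : K | a e + y • b e ∈ U S}).Finite := by
      refine Set.Finite.union (hZ.biUnion fun z _ => finite_setOf_add_smul_mem (hline z))
        (Set.Finite.biUnion (Finset.finite_toSet _) fun S hS => ?_)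
      rw [Finset.mem_coe, Finset.mem_filter] at hS
      exact finite_setOf_add_smul_mem (htight S hS.1 hS.2)
    -- a vector `h` of the plane of `e` in general position
    obtain ⟨y, hy⟩ := hbad.exists_notMem
    simp only [Set.mem_union, Set.mem_iUnion, Set.mem_ofPred_eq, not_or, not_exists] at hy
    obtain ⟨hyZ, hyU⟩ := hy
    obtain ⟨h, hh⟩ : ∃ h, h = a e + y • b e := ⟨_, rfl⟩
    rw [← hh] at hyZ hyU
    have hU0 : U ∅ = ⊥ := by simp [hU]
    have hh0 : h ≠ 0 := fun h0 => hyU ∅ (by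
      rw [Finset.mem_filter, hU0, finrank_bot]
      simp) (h0 ▸ zero_mem _)
    set π := (K ∙ h).mkQ with hπ
    have hπ0 : ∀ x, π x = 0 ↔ x ∈ K ∙ h := fun x => Submodule.Quotient.mk_eq_zero _
    have hπh : π h = 0 := (hπ0 h).2 (mem_span_singleton_self h)
    have hb0 : π (b e) ≠ 0 := fun hb => by
      rw [hπ0] at hb
      refine hline h ⟨?_, hb⟩
      have hae : a e = h - y • b e := by rw [hh, add_sub_cancel_right]
      rw [hae]
      exact (K ∙ h).sub_mem (mem_span_singleton_self h) ((K ∙ h).smul_mem y hb)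
    have hZ' : ∀ z ∈ insert (π (b e)) (π '' Z), z ≠ 0 := by
      rintro _ (rfl | ⟨z, hz, rfl⟩)
      · exact hb0
      · intro h0
        rw [hπ0, mem_span_singleton] at h0
        obtain ⟨c, hc⟩ := h0
        have hc0 : c ≠ 0 := fun hc0 => hZ0 z hz (by rw [← hc, hc0, zero_smul])
        refine hyZ z hz (mem_span_singleton.2 ⟨c⁻¹, ?_⟩)
        rw [← hc, inv_smul_smul₀ hc0]
    -- modulo `h` the rank drops only if `h` lies in the span, and then `S` is not tight
    have hrank : ∀ S : Finset ι, S ⊆ T → S.Nonempty → S.card + 1 ≤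
        finrank K (span K ((fun i => π (a i)) '' S ∪ (fun i => π (b i)) '' S)) := by
      intro S hS hS0
      have h1 : span K ((fun i => π (a i)) '' S ∪ (fun i => π (b i)) '' S) = (U S).map π := by
        rw [hU, map_span, Set.image_union, Set.image_image, Set.image_image]
      rw [h1]
      have h2 := hT S (hS.trans (Finset.subset_insert e T)) hS0
      obtain ⟨h3, h4⟩ := finrank_le_finrank_map_mkQ h (U S)
      by_cases h5 : h ∈ U S
      · have h6 : S.card + 2 ≤ finrank K (U S) := by
          by_contra h7
          exact hyU S (by simp only [Finset.mem_filter, Finset.mem_powerset]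
                          exact ⟨hS, by omega⟩) h5
        have : finrank K (U S) ≤ finrank K ((U S).map π) + 1 := h3
        omega
      · exact h2.trans (h4 h5)
    -- adding `b e` to the vectors to be avoided keeps `P` nonzero on the plane of `e`
    obtain ⟨P, hPZ, hPT⟩ := ih (fun i => π (a i)) (fun i => π (b i)) (insert (π (b e)) (π '' Z))
      ((hZ.image _).insert _) hZ' hrank
    refine ⟨P.comp π, fun z hz => hPZ _ (Or.inr ⟨z, hz, rfl⟩), ?_⟩
    have hPb : P (π (b e)) ≠ 0 := hPZ _ (Or.inl rfl)
    have hPa : P (π (a e)) = - (y * P (π (b e))) := by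
      have h1 : π h = π (a e) + y • π (b e) := by rw [← map_smul, ← map_add, ← hh]
      have : P (π (a e)) + y * P (π (b e)) = 0 := by
        rw [← smul_eq_mul, ← map_smul, ← map_add, ← h1, hπh, map_zero]
      exact eq_neg_of_add_eq_zero_left this
    -- the kernel of the lifted functional meets the plane of `e` in the line of `h`
    have hwe : (P.comp π) (b e) • a e - (P.comp π) (a e) • b e = P (π (b e)) • h := by
      rw [LinearMap.comp_apply, LinearMap.comp_apply, hPa, neg_smul, sub_neg_eq_add,
        mul_comm, mul_smul, ← smul_add, ← hh]
    rw [Finset.coe_insert, ← Set.singleton_union, ← LinearIndepOn.quotient_iff_union]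
    · have hspan : span K ((fun e => (P.comp π) (b e) • a e - (P.comp π) (a e) • b e) '' {e}) =
          K ∙ h := by
        rw [Set.image_singleton, hwe, span_singleton_smul_eq (IsUnit.mk0 _ hPb)]
      rw [hspan]
      exact hPT
    · rw [linearIndepOn_singleton_iff, hwe]
      exact smul_ne_zero hPb hh0
    · simpa using he

end PlaneSection


/-! ### Counting sign patterns -/

section SignPatterns

variable {ι V : Type*} [AddCommGroup V] [Module ℝ V]

/-- The sign patterns of the functionals `f i`, `i ∈ s`, at the points where none of them
vanishes, each pattern recorded as the set of indices with positive value. They correspond to the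
regions of the arrangement of the hyperplanes `ker (f i)`; there are none if some `f i` is zero. -/
def signPatterns (f : ι → Dual ℝ V) (s : Finset ι) : Set (Set ι) :=
  {t | ∃ u, (∀ i ∈ s, f i u ≠ 0) ∧ t = {i | i ∈ s ∧ 0 < f i u}}

/-- Sign patterns are unchanged by small perturbations in a given direction. -/
theorem exists_perturbation (f : ι → Dual ℝ V) (s : Finset ι) {u : V} (hu : ∀ i ∈ s, f i u ≠ 0)
    (w : V) : ∃ δ > 0, ∀ ε : ℝ, |ε| < δ → ∀ i ∈ s,
      f i (u + ε • w) ≠ 0 ∧ (0 < f i (u + ε • w) ↔ 0 < f i u) := by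
  have h : ∀ᶠ ε : ℝ in nhds 0, ∀ i ∈ s, 0 < f i u * f i (u + ε • w) := by
    rw [Filter.eventually_all_finset]
    intro i hi
    have hc : Continuous fun ε : ℝ => f i u * f i (u + ε • w) := by
      simp only [map_add, map_smul, smul_eq_mul]
      fun_prop
    refine hc.continuousAt.eventually (lt_mem_nhds ?_)
    simpa using mul_self_pos.2 (hu i hi)
  obtain ⟨δ, hδ, hh⟩ := Metric.eventually_nhds_iff.1 h
  refine ⟨δ, hδ, fun ε hε i hi => ?_⟩
  have h1 := hh (by simpa using hε) i hi
  rcases pos_and_pos_or_neg_and_neg_of_mul_pos h1 with h2 | h2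
  · exact ⟨h2.2.ne', iff_of_true h2.2 h2.1⟩
  · exact ⟨h2.2.ne, iff_of_false h2.2.not_gt h2.1.not_gt⟩

/-- Deletion and restriction for sign patterns. -/
theorem ncard_signPatterns_insert [DecidableEq ι] (f : ι → Dual ℝ V) {s : Finset ι} {a : ι}
    (ha : a ∉ s) (hfa : f a ≠ 0) :
    (signPatterns f (insert a s)).ncard = (signPatterns f s).ncard +
      (signPatterns (fun i => (f a).ker.subtype.dualMap (f i)) s).ncard := by
  set P : Set (Set ι) := {t | ∃ u, (∀ i ∈ s, f i u ≠ 0) ∧ 0 < f a u ∧ t = {i | i ∈ s ∧ 0 < f i u}}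
    with hP
  set N : Set (Set ι) := {t | ∃ u, (∀ i ∈ s, f i u ≠ 0) ∧ f a u < 0 ∧ t = {i | i ∈ s ∧ 0 < f i u}}
    with hN
  obtain ⟨w, hw⟩ : ∃ w, f a w = 1 := by
    obtain ⟨w, hw⟩ := DFunLike.ne_iff.1 hfa
    exact ⟨(f a w)⁻¹ • w, by simpa using inv_mul_cancel₀ hw⟩
  -- a point on `ker (f a)` can be pushed to the positive side
  have hunion : P ∪ N = signPatterns f s := by
    ext t
    constructor
    · rintro (⟨u, h1, -, h2⟩ | ⟨u, h1, -, h2⟩) <;> exact ⟨u, h1, h2⟩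
    · rintro ⟨u, h1, rfl⟩
      rcases lt_trichotomy (f a u) 0 with h | h | h
      · exact Or.inr ⟨u, h1, h, rfl⟩
      · obtain ⟨δ, hδ, hh⟩ := exists_perturbation f s h1 w
        have h2 := hh (δ / 2) (by rw [abs_of_pos (by positivity)]; linarith)
        refine Or.inl ⟨u + (δ / 2) • w, fun i hi => (h2 i hi).1, ?_, ?_⟩
        · rw [map_add, map_smul, h, hw]
          simpa using hδ
        · ext i
          exact and_congr_right fun hi => (h2 i hi).2.symm
      · exact Or.inl ⟨u, h1, h, rfl⟩
  -- a segment joining the two sides of `ker (f a)` crosses it without changing the other signs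
  have hinter : P ∩ N = signPatterns (fun i => (f a).ker.subtype.dualMap (f i)) s := by
    ext t
    constructor
    · rintro ⟨⟨u, h1, h2, rfl⟩, ⟨v, h3, h4, h5⟩⟩
      have h6 : ∀ i ∈ s, (0 < f i u ↔ 0 < f i v) := fun i hi => by
        have := Set.ext_iff.1 h5 i
        simpa [hi] using this
      have hx : f a ((-f a v) • u + f a u • v) = 0 := by simp; ring
      have hpos : ∀ i ∈ s, (0 < f i u → 0 < f i ((-f a v) • u + f a u • v)) ∧
          (f i u < 0 → f i ((-f a v) • u + f a u • v) < 0) := by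
        intro i hi
        rw [map_add, map_smul, map_smul, smul_eq_mul, smul_eq_mul]
        refine ⟨fun h => ?_, fun h => ?_⟩
        · have h7 := (h6 i hi).1 h
          exact add_pos (mul_pos (neg_pos.2 h4) h) (mul_pos h2 h7)
        · have h7 : f i v < 0 :=
            lt_of_le_of_ne (not_lt.1 fun h8 => ((h6 i hi).2 h8).not_gt h) (h3 i hi)
          exact add_neg (mul_neg_of_pos_of_neg (neg_pos.2 h4) h) (mul_neg_of_pos_of_neg h2 h7)
      refine ⟨⟨_, hx⟩, fun i hi => ?_, ?_⟩
      · rcases lt_or_gt_of_ne (h1 i hi) with h | h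
        · exact ((hpos i hi).2 h).ne
        · exact ((hpos i hi).1 h).ne'
      · ext i
        refine and_congr_right fun hi => ⟨(hpos i hi).1, fun h => ?_⟩
        by_contra h8
        exact ((hpos i hi).2 (lt_of_le_of_ne (not_lt.1 h8) (h1 i hi))).not_gt h
    · rintro ⟨⟨u, hu⟩, h1, rfl⟩
      replace hu : f a u = 0 := hu
      replace h1 : ∀ i ∈ s, f i u ≠ 0 := h1
      obtain ⟨δ, hδ, hh⟩ := exists_perturbation f s h1 w
      have h2 := hh (δ / 2) (by rw [abs_of_pos (by positivity)]; linarith)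
      have h3 := hh (-(δ / 2)) (by rw [abs_neg, abs_of_pos (by positivity)]; linarith)
      refine ⟨⟨u + (δ / 2) • w, fun i hi => (h2 i hi).1, ?_, ?_⟩,
        ⟨u + (-(δ / 2)) • w, fun i hi => (h3 i hi).1, ?_, ?_⟩⟩
      · rw [map_add, map_smul, hu, hw]
        simpa using hδ
      · ext i
        exact and_congr_right fun hi => (h2 i hi).2.symm
      · rw [map_add, map_smul, hu, hw]
        simpa using hδ
      · ext i
        exact and_congr_right fun hi => (h3 i hi).2.symm
  have hPs : P ⊆ 𝒫 (s : Set ι) := by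
    rintro _ ⟨u, -, -, rfl⟩ i hi
    exact hi.1
  have hNs : N ⊆ 𝒫 (s : Set ι) := by
    rintro _ ⟨u, -, -, rfl⟩ i hi
    exact hi.1
  have hfin : (𝒫 (s : Set ι)).Finite := s.finite_toSet.finite_subsets
  have hsplit : signPatterns f (insert a s) = insert a '' P ∪ N := by
    ext t
    constructor
    · rintro ⟨u, h1, rfl⟩
      have h2 : ∀ i ∈ s, f i u ≠ 0 := fun i hi => h1 i (Finset.mem_insert_of_mem hi)
      rcases lt_or_gt_of_ne (h1 a (Finset.mem_insert_self a s)) with h | h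
      · refine Or.inr ⟨u, h2, h, ?_⟩
        ext i
        simp only [Finset.mem_insert, Set.mem_ofPred_eq]
        refine and_congr_left fun hi => ⟨fun h3 => h3.resolve_left ?_, Or.inr⟩
        rintro rfl
        exact h.not_gt hi
      · refine Or.inl ⟨_, ⟨u, h2, h, rfl⟩, ?_⟩
        ext i
        simp only [Finset.mem_insert, Set.mem_insert_iff, Set.mem_ofPred_eq]
        constructor
        · rintro (rfl | h3)
          · exact ⟨Or.inl rfl, h⟩
          · exact ⟨Or.inr h3.1, h3.2⟩
        · rintro ⟨h3 | h3, h4⟩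
          · exact Or.inl h3
          · exact Or.inr ⟨h3, h4⟩
    · rintro (⟨_, ⟨u, h2, h, rfl⟩, rfl⟩ | ⟨u, h2, h, rfl⟩)
      · refine ⟨u, ?_, ?_⟩
        · intro i hi
          rcases Finset.mem_insert.1 hi with rfl | hi
          · exact h.ne'
          · exact h2 i hi
        · ext i
          simp only [Finset.mem_insert, Set.mem_insert_iff, Set.mem_ofPred_eq]
          constructor
          · rintro (rfl | h3)
            · exact ⟨Or.inl rfl, h⟩
            · exact ⟨Or.inr h3.1, h3.2⟩
          · rintro ⟨h3 | h3, h4⟩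
            · exact Or.inl h3
            · exact Or.inr ⟨h3, h4⟩
      · refine ⟨u, ?_, ?_⟩
        · intro i hi
          rcases Finset.mem_insert.1 hi with rfl | hi
          · exact h.ne
          · exact h2 i hi
        · ext i
          simp only [Finset.mem_insert, Set.mem_ofPred_eq]
          refine and_congr_left fun hi => ⟨Or.inr, fun h3 => h3.resolve_left ?_⟩
          rintro rfl
          exact h.not_gt hi
  have hdisj : Disjoint (insert a '' P) N := by
    rw [Set.disjoint_left]
    rintro _ ⟨t, -, rfl⟩ h
    exact ha (hNs h (Set.mem_insert a t))
  have hinj : Set.InjOn (insert a) P := by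
    intro t ht t' ht' h
    have h1 : ∀ t ∈ P, insert a t \ {a} = t := fun t ht =>
      Set.insert_sdiff_self_of_notMem fun h => ha (hPs ht h)
    rw [← h1 t ht, h, h1 t' ht']
  rw [hsplit, Set.ncard_union_eq hdisj ((hfin.subset hPs).image _) (hfin.subset hNs),
    hinj.ncard_image, ← hinter, ← hunion,
    Set.ncard_union_add_ncard_inter _ _ (hfin.subset hPs) (hfin.subset hNs)]

/-- Restricting functionals to the kernel of one of them contracts their matroid by it. -/
theorem linearIndepOn_restrict_ker_iff (f : ι → Dual ℝ V) {S : Set ι} {a : ι} (ha : a ∉ S)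
    (hfa : f a ≠ 0) :
    LinearIndepOn ℝ (fun i => (f a).ker.subtype.dualMap (f i)) S ↔
      LinearIndepOn ℝ f (insert a S) := by
  set ρ := (f a).ker.subtype.dualMap with hρ
  have hker : ρ.ker = span ℝ (f '' {a}) := by
    ext g
    rw [LinearMap.mem_ker, Set.image_singleton, mem_span_singleton]
    constructor
    · intro h
      have h1 : ⨅ _ : Unit, (f a).ker ≤ g.ker := by
        rw [ciInf_const]
        intro x hx
        exact LinearMap.congr_fun h ⟨x, hx⟩
      have h2 := mem_span_of_iInf_ker_le_ker h1
      rwa [Set.range_const, mem_span_singleton] at h2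
    · rintro ⟨c, rfl⟩
      ext ⟨x, hx⟩
      have : f a x = 0 := hx
      simp [hρ, this]
  rw [← Set.singleton_union, ← LinearIndepOn.quotient_iff_union
    (linearIndepOn_singleton_iff ℝ |>.2 hfa) (by simpa using ha), ← hker]
  have h1 : (fun i => ρ (f i)) = (ρ.ker.liftQ ρ le_rfl) ∘ (ρ.ker.mkQ ∘ f) := by
    ext i
    simp
  rw [h1]
  refine LinearMap.linearIndepOn_iff_of_injOn _ (Function.Injective.injOn ?_)
  rw [← LinearMap.ker_eq_bot]
  exact ker_liftQ_eq_bot' _ _ rfl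

end SignPatterns

/-- The number of sign patterns depends only on the matroid of the functionals. -/
theorem ncard_signPatterns_congr {ι : Type*} (s : Finset ι) :
    ∀ {V V' : Type*} [AddCommGroup V] [Module ℝ V] [AddCommGroup V'] [Module ℝ V']
      (f : ι → Dual ℝ V) (f' : ι → Dual ℝ V'),
      (∀ S : Set ι, S ⊆ s → (LinearIndepOn ℝ f S ↔ LinearIndepOn ℝ f' S)) →
      (signPatterns f s).ncard = (signPatterns f' s).ncard := by
  classical
  induction s using Finset.induction_on with
  | empty =>
    intro V V' _ _ _ _ f f' _
    simp [signPatterns]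
  | insert a s ha ih =>
    intro V V' _ _ _ _ f f' h
    have h0 : f a = 0 ↔ f' a = 0 := by
      have := h {a} (by simp)
      rw [linearIndepOn_singleton_iff, linearIndepOn_singleton_iff] at this
      exact not_iff_not.1 this
    by_cases hfa : f a = 0
    · have h1 : signPatterns f (insert a s) = ∅ := by
        refine Set.eq_empty_of_forall_notMem ?_
        rintro _ ⟨u, hu, -⟩
        exact hu a (by simp) (by simp [hfa])
      have h2 : signPatterns f' (insert a s) = ∅ := by
        refine Set.eq_empty_of_forall_notMem ?_
        rintro _ ⟨u, hu, -⟩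
        exact hu a (by simp) (by simp [h0.1 hfa])
      rw [h1, h2]
    · rw [ncard_signPatterns_insert f ha hfa,
        ncard_signPatterns_insert f' ha fun h1 => hfa (h0.2 h1)]
      congr 1
      · exact ih f f' fun S hS => h S (hS.trans (by simp))
      · refine ih _ _ fun S hS => ?_
        have haS : a ∉ S := fun h1 => ha (hS h1)
        rw [linearIndepOn_restrict_ker_iff f haS hfa,
          linearIndepOn_restrict_ker_iff f' haS fun h1 => hfa (h0.2 h1)]
        refine h _ ?_
        rw [Finset.coe_insert]
        exact Set.insert_subset_insert hS

theorem ncard_signPatterns_univ_comp {ι κ V : Type*} [Fintype ι] [Fintype κ] [AddCommGroup V]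
    [Module ℝ V] (f : ι → Dual ℝ V) (σ : κ ≃ ι) :
    (signPatterns (f ∘ σ) Finset.univ).ncard = (signPatterns f Finset.univ).ncard := by
  rw [← Set.ncard_image_of_injective (signPatterns f Finset.univ)
    (Set.preimage_injective.2 σ.surjective)]
  congr 1
  ext t
  constructor
  · rintro ⟨u, h1, rfl⟩
    refine ⟨_, ⟨u, fun i _ => ?_, rfl⟩, ?_⟩
    · simpa using h1 (σ.symm i) (Finset.mem_univ _)
    · ext i
      simp
  · rintro ⟨_, ⟨u, h1, rfl⟩, rfl⟩
    refine ⟨u, fun i _ => h1 _ (Finset.mem_univ _), ?_⟩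
    ext i
    simp


/-! ### The intersection poset and its Möbius function -/

theorem mem_finset_inf {E : Type*} [AddCommGroup E] [Module ℝ E]
    {S : Finset (AffineSubspace ℝ E)} {x : E} : x ∈ S.inf id ↔ ∀ H ∈ S, x ∈ H := by
  classical
  induction S using Finset.induction_on with
  | empty => simp
  | insert a S _ ih => simp [Finset.inf_insert, AffineSubspace.mem_inf_iff, ih]

theorem mem_intersections {E : Type*} [AddCommGroup E] [Module ℝ E]
    {A : Finset (AffineSubspace ℝ E)} {X : AffineSubspace ℝ E} :
    X ∈ intersections A ↔ (∃ S ⊆ A, S.inf id = X) ∧ (X : Set E).Nonempty := by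
  simp [intersections]

section Mu

variable {α β : Type*} [PartialOrder α] [PartialOrder β] [LocallyFiniteOrder α]
  [LocallyFiniteOrder β] [DecidableEq α] [DecidableEq β]

theorem mu_orderIso_apply [Finite α] (e : α ≃o β) (a b : α) :
    IncidenceAlgebra.mu ℤ (e a) (e b) = IncidenceAlgebra.mu ℤ a b := by
  induction b using WellFoundedLT.induction with
  | ind b ih =>
    rw [IncidenceAlgebra.mu_apply, IncidenceAlgebra.mu_apply]
    simp only [EmbeddingLike.apply_eq_iff_eq]
    congr 2
    symm
    refine Finset.sum_bij (fun x _ => e x) (fun x hx => ?_) (fun x _ y _ h => e.injective h)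
      (fun y hy => ⟨e.symm y, ?_, e.apply_symm_apply y⟩) fun x hx => ?_
    · simpa using hx
    · rw [Finset.mem_Ico] at hy ⊢
      rwa [e.le_symm_apply, e.symm_apply_lt]
    · exact (ih x (Finset.mem_Ico.1 hx).2).symm

end Mu

open Classical in
theorem moebius_orderIso_apply {E F : Type*} [AddCommGroup E] [Module ℝ E] [AddCommGroup F]
    [Module ℝ F] {A : Finset (AffineSubspace ℝ E)} {B : Finset (AffineSubspace ℝ F)}
    (e : IntersectionPoset A ≃o IntersectionPoset B) (x y : IntersectionPoset A) :
    moebius B (e x) (e y) = moebius A x y := by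
  have : Finite (IntersectionPoset A) := inferInstanceAs (Finite {X // X ∈ intersections A})
  let : LocallyFiniteOrder (IntersectionPoset A) := Fintype.toLocallyFiniteOrder
  let : LocallyFiniteOrder (IntersectionPoset B) := Fintype.toLocallyFiniteOrder
  exact mu_orderIso_apply e x y

theorem whole_le {E : Type*} [AddCommGroup E] [Module ℝ E] {A : Finset (AffineSubspace ℝ E)}
    (x : IntersectionPoset A) : whole A ≤ x :=
  show (OrderDual.ofDual x).1 ≤ ⊤ from le_top

theorem orderIso_whole {E F : Type*} [AddCommGroup E] [Module ℝ E] [AddCommGroup F]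
    [Module ℝ F] {A : Finset (AffineSubspace ℝ E)} {B : Finset (AffineSubspace ℝ F)}
    (e : IntersectionPoset A ≃o IntersectionPoset B) : e (whole A) = whole B :=
  le_antisymm (by rw [← e.le_symm_apply]; exact whole_le _) (whole_le _)

/-! ### Families of vectors with the same independent subfamilies -/

section Matroid

variable {ι K V V' : Type*} [Field K] [AddCommGroup V] [Module K V] [AddCommGroup V']
  [Module K V'] {f : ι → V} {f' : ι → V'}

/-- A basis of a subfamily of one family is a basis of the corresponding subfamily of any family
with the same independent subfamilies. -/
theorem exists_common_basis (h : ∀ S : Set ι, LinearIndepOn K f S ↔ LinearIndepOn K f' S)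
    (S : Set ι) : ∃ I ⊆ S, LinearIndepOn K f I ∧ span K (f '' I) = span K (f '' S) ∧
      span K (f' '' I) = span K (f' '' S) := by
  obtain ⟨I, hIS, -, hspan, hI⟩ := exists_linearIndepOn_extension (linearIndepOn_empty K f)
    (Set.empty_subset S)
  refine ⟨I, hIS, hI, le_antisymm (span_mono (Set.image_mono hIS)) (span_le.2 hspan),
    le_antisymm (span_mono (Set.image_mono hIS)) (span_le.2 ?_)⟩
  rintro _ ⟨i, hi, rfl⟩
  have h1 := hI.mem_span_iff.1 (hspan ⟨i, hi, rfl⟩)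
  rw [h] at h1
  exact ((h I).1 hI).mem_span_iff.2 h1

theorem mem_span_image_iff_of_linearIndepOn_iff
    (h : ∀ S : Set ι, LinearIndepOn K f S ↔ LinearIndepOn K f' S) (S : Set ι) (i : ι) :
    f i ∈ span K (f '' S) ↔ f' i ∈ span K (f' '' S) := by
  obtain ⟨I, -, hI, h1, h2⟩ := exists_common_basis h S
  rw [← h1, ← h2, hI.mem_span_iff, ((h I).1 hI).mem_span_iff, h]

theorem finrank_span_image_of_linearIndepOn {S : Set ι} [Finite ι] (hS : LinearIndepOn K f S) :
    finrank K (span K (f '' S)) = S.ncard := by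
  classical
  have := Fintype.ofFinite S
  rw [Set.image_eq_range, finrank_span_eq_card hS, ← Nat.card_eq_fintype_card, Nat.card_coe_set_eq]

theorem finrank_span_image_eq_of_linearIndepOn_iff [Finite ι]
    (h : ∀ S : Set ι, LinearIndepOn K f S ↔ LinearIndepOn K f' S) (S : Set ι) :
    finrank K (span K (f '' S)) = finrank K (span K (f' '' S)) := by
  obtain ⟨I, -, hI, h1, h2⟩ := exists_common_basis h S
  rw [← h1, ← h2, finrank_span_image_of_linearIndepOn hI,
    finrank_span_image_of_linearIndepOn ((h I).1 hI)]

/-- The flats of the matroid of a family of vectors, as subsets of the index set. -/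
def IsFlat (K : Type*) [Field K] [Module K V] (f : ι → V) (s : Set ι) : Prop :=
  ∀ i, f i ∈ span K (f '' s) → i ∈ s

end Matroid

/-! ### Central arrangements and their characteristic polynomials -/

section Central

variable {ι V V' : Type*} [AddCommGroup V] [Module ℝ V] [AddCommGroup V'] [Module ℝ V']

open Classical in
/-- The arrangement of the hyperplanes through `p` on which the functionals `f i` are constant. -/
noncomputable def centralArrangement [Fintype ι] (f : ι → Dual ℝ V) (p : V) :
    Finset (AffineSubspace ℝ V) :=
  Finset.univ.image fun i => AffineSubspace.mk' p (f i).ker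

theorem biInf_ker_le_ker_iff [Finite ι] {f : ι → Dual ℝ V} {s : Set ι} {g : Dual ℝ V} :
    ⨅ i ∈ s, (f i).ker ≤ g.ker ↔ g ∈ span ℝ (f '' s) := by
  constructor
  · intro h
    rw [iInf_subtype'] at h
    have := mem_span_of_iInf_ker_le_ker h
    rwa [Set.image_eq_range]
  · intro h x hx
    induction h using span_induction with
    | mem g hg =>
      obtain ⟨i, hi, rfl⟩ := hg
      simp only [mem_iInf] at hx
      exact hx i hi
    | zero => simp
    | add g g' _ _ h h' => simp_all
    | smul c g _ h => simp_all

theorem finrank_biInf_ker_add [FiniteDimensional ℝ V] (f : ι → Dual ℝ V) (s : Set ι) :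
    finrank ℝ ↥(⨅ i ∈ s, (f i).ker) + finrank ℝ (span ℝ (f '' s)) = finrank ℝ V := by
  have h : ⨅ i ∈ s, (f i).ker = (span ℝ (f '' s)).dualCoannihilator := by
    ext x
    simp only [mem_iInf, mem_dualCoannihilator, LinearMap.mem_ker]
    constructor
    · intro h g hg
      induction hg using span_induction with
      | mem g hg =>
        obtain ⟨i, hi, rfl⟩ := hg
        exact h i hi
      | zero => simp
      | add g g' _ _ h h' => simp_all
      | smul c g _ h => simp_all
    · exact fun h i hi => h _ (subset_span ⟨i, hi, rfl⟩)
  rw [h, add_comm, Subspace.finrank_add_finrank_dualCoannihilator_eq]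

theorem mk'_le_mk'_iff {p : V} {D D' : Submodule ℝ V} :
    AffineSubspace.mk' p D ≤ AffineSubspace.mk' p D' ↔ D ≤ D' := by
  constructor
  · intro h x hx
    have h1 : x + p ∈ AffineSubspace.mk' p D := by simpa [AffineSubspace.mem_mk'] using hx
    simpa [AffineSubspace.mem_mk'] using h h1
  · intro h x hx
    exact h hx

theorem mk'_mem_intersections_centralArrangement [Fintype ι] (f : ι → Dual ℝ V) (p : V)
    (s : Set ι) :
    AffineSubspace.mk' p (⨅ i ∈ s, (f i).ker) ∈ intersections (centralArrangement f p) := by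
  classical
  refine mem_intersections.2 ⟨⟨s.toFinset.image fun i => AffineSubspace.mk' p (f i).ker,
    Finset.image_subset_image (Finset.subset_univ _), ?_⟩,
    p, AffineSubspace.self_mem_mk' p _⟩
  ext x
  rw [mem_finset_inf]
  simp [AffineSubspace.mem_mk']

theorem exists_eq_mk'_of_mem_intersections [Fintype ι] {f : ι → Dual ℝ V} {p : V}
    {X : AffineSubspace ℝ V} (hX : X ∈ intersections (centralArrangement f p)) :
    ∃ s : Set ι, X = AffineSubspace.mk' p (⨅ i ∈ s, (f i).ker) := by
  classical
  obtain ⟨⟨S, hS, rfl⟩, -⟩ := mem_intersections.1 hX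
  refine ⟨{i | AffineSubspace.mk' p (f i).ker ∈ S}, ?_⟩
  ext x
  rw [mem_finset_inf]
  simp only [AffineSubspace.mem_mk', mem_iInf, Set.mem_ofPred_eq]
  constructor
  · exact fun h i hi => h _ hi
  · intro h H hH
    obtain ⟨i, -, rfl⟩ := Finset.mem_image.1 (hS hH)
    exact h i hH

/-- The intersection poset of a central arrangement is the lattice of flats of the matroid of its
normals. -/
noncomputable def flatsOrderIso [Fintype ι] (f : ι → Dual ℝ V) (p : V) :
    {s : Set ι // IsFlat ℝ f s} ≃o IntersectionPoset (centralArrangement f p) :=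
  RelIso.ofSurjective
    (OrderEmbedding.ofMapLEIff (fun s => OrderDual.toDual
      ⟨AffineSubspace.mk' p (⨅ i ∈ s.1, (f i).ker),
        mk'_mem_intersections_centralArrangement f p s.1⟩) fun s t => by
      show AffineSubspace.mk' p (⨅ i ∈ t.1, (f i).ker) ≤
        AffineSubspace.mk' p (⨅ i ∈ s.1, (f i).ker) ↔ s.1 ⊆ t.1
      rw [mk'_le_mk'_iff]
      refine ⟨fun h i hi => t.2 i (biInf_ker_le_ker_iff.1 (h.trans (biInf_le _ hi))),
        fun h => biInf_mono h⟩)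
    fun X => by
      obtain ⟨s, hs⟩ := exists_eq_mk'_of_mem_intersections (OrderDual.ofDual X).2
      refine ⟨⟨{i | f i ∈ span ℝ (f '' s)}, fun i hi => ?_⟩, ?_⟩
      · have hle : span ℝ (f '' {i | f i ∈ span ℝ (f '' s)}) ≤ span ℝ (f '' s) := by
          rw [span_le]
          rintro _ ⟨j, hj, rfl⟩
          exact hj
        exact hle hi
      · refine OrderDual.ofDual.injective (Subtype.ext ?_)
        rw [hs]
        show AffineSubspace.mk' p _ = AffineSubspace.mk' p _
        congr 1
        refine le_antisymm (biInf_mono fun i hi => subset_span ⟨i, hi, rfl⟩)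
          (le_iInf₂ fun i hi => biInf_ker_le_ker_iff.2 hi)

theorem finrank_direction_flatsOrderIso [Fintype ι] [FiniteDimensional ℝ V] (f : ι → Dual ℝ V)
    (p : V) (s : {s : Set ι // IsFlat ℝ f s}) :
    finrank ℝ (OrderDual.ofDual (flatsOrderIso f p s)).1.direction +
      finrank ℝ (span ℝ (f '' s.1)) = finrank ℝ V := by
  have h : (OrderDual.ofDual (flatsOrderIso f p s)).1.direction = ⨅ i ∈ s.1, (f i).ker :=
    AffineSubspace.direction_mk' _ _
  rw [h, finrank_biInf_ker_add]

/-- The characteristic polynomial of a central arrangement depends, up to a power of `X` that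
accounts for the dimension, only on the matroid of its normals. -/
theorem charPoly_centralArrangement_congr [Fintype ι] [FiniteDimensional ℝ V]
    [FiniteDimensional ℝ V'] {f : ι → Dual ℝ V} {f' : ι → Dual ℝ V'}
    (h : ∀ S : Set ι, LinearIndepOn ℝ f S ↔ LinearIndepOn ℝ f' S) (p : V) (p' : V') :
    X ^ finrank ℝ V' * charPoly (centralArrangement f p) =
      X ^ finrank ℝ V * charPoly (centralArrangement f' p') := by
  classical
  have hflat : ∀ s, IsFlat ℝ f s ↔ IsFlat ℝ f' s := fun s =>
    forall_congr' fun i => by rw [mem_span_image_iff_of_linearIndepOn_iff h]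
  let ψ : {s : Set ι // IsFlat ℝ f s} ≃o {s : Set ι // IsFlat ℝ f' s} :=
    ⟨Equiv.subtypeEquivRight hflat, Iff.rfl⟩
  let e := (flatsOrderIso f p).symm.trans (ψ.trans (flatsOrderIso f' p'))
  rw [charPoly, charPoly, Finset.mul_sum, Finset.mul_sum]
  refine Fintype.sum_equiv e.toEquiv _ _ fun x => ?_
  obtain ⟨s, rfl⟩ := (flatsOrderIso f p).surjective x
  have he : e (flatsOrderIso f p s) = flatsOrderIso f' p' (ψ s) := by simp [e]
  have h1 := finrank_direction_flatsOrderIso f p s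
  have h2 := finrank_direction_flatsOrderIso f' p' (ψ s)
  have h3 : finrank ℝ (span ℝ (f '' s.1)) = finrank ℝ (span ℝ (f' '' (ψ s).1)) :=
    finrank_span_image_eq_of_linearIndepOn_iff h s.1
  have h4 : moebius _ (whole _) (e (flatsOrderIso f p s)) =
      moebius _ (whole _) (flatsOrderIso f p s) := by
    rw [← orderIso_whole e, moebius_orderIso_apply]
  show _ = X ^ finrank ℝ V * (C (moebius _ (whole _) (e (flatsOrderIso f p s))) *
    X ^ finrank ℝ (OrderDual.ofDual (e (flatsOrderIso f p s))).1.direction)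
  rw [h4, mul_left_comm, mul_left_comm (X ^ finrank ℝ V), ← pow_add, ← pow_add, he]
  congr 2
  omega

end Central


/-! ### Equations of hyperplanes -/

section Equation

variable {E : Type*} [AddCommGroup E] [Module ℝ E] [FiniteDimensional ℝ E]

theorem IsHyperplane.exists_equation {H : AffineSubspace ℝ E}
    (hH : IsHyperplane H) : ∃ φ : Dual ℝ (E × ℝ), φ ∘ₗ LinearMap.inl ℝ E ℝ ≠ 0 ∧
      ∀ x, x ∈ H ↔ φ (x, 1) = 0 := by
  obtain ⟨⟨x₀, hx₀⟩, hdim⟩ := hH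
  have hlt : H.direction < ⊤ := by
    rw [lt_top_iff_ne_top]
    intro h
    rw [h, finrank_top] at hdim
    omega
  obtain ⟨α, hα, hle⟩ := H.direction.exists_le_ker_of_lt_top hlt
  have hker : H.direction = α.ker := by
    refine Submodule.eq_of_le_of_finrank_eq hle ?_
    have := Module.Dual.finrank_ker_add_one_of_ne_zero hα
    omega
  refine ⟨α.coprod (LinearMap.toSpanSingleton ℝ ℝ (-α x₀)), by simpa using hα, fun x => ?_⟩
  rw [← AffineSubspace.vsub_right_mem_direction_iff_mem hx₀, hker]
  simp [sub_eq_add_neg]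

open Classical in
/-- A functional `(x, y) ↦ α x - c y` such that `{x | α x = c}` is the hyperplane `H`; it is zero
if `H` is not a hyperplane. -/
noncomputable def equation (H : AffineSubspace ℝ E) : Dual ℝ (E × ℝ) :=
  if h : IsHyperplane H then h.exists_equation.choose else 0

/-- The linear part `α` of the equation of the hyperplane `{x | α x = c}`. -/
noncomputable def normal (H : AffineSubspace ℝ E) : Dual ℝ E :=
  equation H ∘ₗ LinearMap.inl ℝ E ℝ

variable {H H' : AffineSubspace ℝ E}

theorem IsHyperplane.normal_ne_zero (hH : IsHyperplane H) : normal H ≠ 0 := by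
  rw [normal, equation, dif_pos hH]
  exact hH.exists_equation.choose_spec.1

theorem IsHyperplane.mem_iff (hH : IsHyperplane H) {x : E} : x ∈ H ↔ equation H (x, 1) = 0 := by
  rw [equation, dif_pos hH]
  exact hH.exists_equation.choose_spec.2 x

theorem equation_apply (H : AffineSubspace ℝ E) (x : E) (y : ℝ) :
    equation H (x, y) = normal H x + y * equation H (0, 1) := by
  rw [normal, LinearMap.comp_apply, LinearMap.inl_apply, ← smul_eq_mul, ← map_smul, ← map_add]
  simp

/-- The functional `β` with `H = {x | β (x - p) = 1}`, for `p` not on `H`. -/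
noncomputable def gauge (p : E) (H : AffineSubspace ℝ E) : Dual ℝ E :=
  -(equation H (p, 1))⁻¹ • normal H

variable {p : E}

theorem IsHyperplane.mem_iff_gauge (hH : IsHyperplane H) (hp : p ∉ H) {x : E} :
    x ∈ H ↔ gauge p H (x - p) = 1 := by
  have h0 : equation H (p, 1) ≠ 0 := fun h => hp (hH.mem_iff.2 h)
  have h1 : normal H (x - p) = equation H (x, 1) - equation H (p, 1) := by
    rw [equation_apply, equation_apply H p, map_sub]
    ring
  rw [hH.mem_iff, gauge, LinearMap.smul_apply, h1, smul_eq_mul]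
  field_simp
  constructor <;> intro h <;> linarith

theorem IsHyperplane.gauge_ne_zero (hH : IsHyperplane H) (hp : p ∉ H) : gauge p H ≠ 0 := by
  obtain ⟨x, hx⟩ := hH.1
  intro h
  have := (hH.mem_iff_gauge hp).1 hx
  simp [h] at this

theorem IsHyperplane.mem_direction_iff_gauge (hH : IsHyperplane H) (hp : p ∉ H) {u : E} :
    u ∈ H.direction ↔ gauge p H u = 0 := by
  obtain ⟨x, hx⟩ := hH.1
  rw [← AffineSubspace.vadd_mem_iff_mem_direction u hx, hH.mem_iff_gauge hp, vadd_eq_add,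
    add_sub_assoc, map_add, (hH.mem_iff_gauge hp).1 hx]
  simp

theorem IsHyperplane.direction_eq_ker_gauge (hH : IsHyperplane H) (hp : p ∉ H) :
    H.direction = (gauge p H).ker := by
  ext u
  rw [hH.mem_direction_iff_gauge hp, LinearMap.mem_ker]

theorem IsHyperplane.eq_of_gauge_eq (hH : IsHyperplane H) (hH' : IsHyperplane H') (hp : p ∉ H)
    (hp' : p ∉ H') (h : gauge p H = gauge p H') : H = H' := by
  ext x
  rw [hH.mem_iff_gauge hp, hH'.mem_iff_gauge hp', h]

end Equation

/-! ### The valid order arrangement -/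

section ValidOrder

variable {E : Type*} [AddCommGroup E] [Module ℝ E] [FiniteDimensional ℝ E] {p : E}
  {H H' : AffineSubspace ℝ E} {A : Finset (AffineSubspace ℝ E)}

/-- The hyperplanes of the valid order arrangement, both for parallel and for intersecting `H`
and `H'`, are given by the differences of the normalized equations. -/
theorem voHyperplane_eq_mk' (hH : IsHyperplane H) (hH' : IsHyperplane H') (hp : p ∉ H)
    (hp' : p ∉ H') (hne : H ≠ H') :
    voHyperplane p H H' = AffineSubspace.mk' p (gauge p H - gauge p H').ker := by
  have hgne : gauge p H - gauge p H' ≠ 0 := fun h =>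
    hne (hH.eq_of_gauge_eq hH' hp hp' (sub_eq_zero.1 h))
  rw [voHyperplane]
  split_ifs with hpar
  · have h1 : (gauge p H).ker = (gauge p H').ker := by
      rw [← hH.direction_eq_ker_gauge hp, ← hH'.direction_eq_ker_gauge hp', hpar.direction_eq]
    rw [hH.direction_eq_ker_gauge hp]
    congr 1
    refine Submodule.eq_of_le_of_finrank_eq (fun x hx => ?_) ?_
    · have hx' : x ∈ (gauge p H').ker := h1 ▸ hx
      rw [LinearMap.mem_ker] at hx hx' ⊢
      rw [LinearMap.sub_apply, hx, hx', sub_zero]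
    · have h2 := Module.Dual.finrank_ker_add_one_of_ne_zero hgne
      have h3 := Module.Dual.finrank_ker_add_one_of_ne_zero (hH.gauge_ne_zero hp)
      omega
  · -- the two hyperplanes meet
    have hmeet : ∃ z, z ∈ H ∧ z ∈ H' := by
      have h1 : ¬ (gauge p H).ker ≤ (gauge p H').ker := fun h => by
        have h2 : (gauge p H).ker = (gauge p H').ker := by
          refine Submodule.eq_of_le_of_finrank_eq h ?_
          have h2 := Module.Dual.finrank_ker_add_one_of_ne_zero (hH'.gauge_ne_zero hp')
          have h3 := Module.Dual.finrank_ker_add_one_of_ne_zero (hH.gauge_ne_zero hp)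
          omega
        refine hpar (AffineSubspace.parallel_iff_direction_eq_and_eq_bot_iff_eq_bot.2 ⟨?_, ?_⟩)
        · rw [hH.direction_eq_ker_gauge hp, hH'.direction_eq_ker_gauge hp', h2]
        · have h3 := (AffineSubspace.nonempty_iff_ne_bot H).1 hH.1
          have h4 := (AffineSubspace.nonempty_iff_ne_bot H').1 hH'.1
          exact iff_of_false h3 h4
      obtain ⟨u, hu, hu'⟩ := SetLike.not_le_iff_exists.1 h1
      rw [LinearMap.mem_ker] at hu hu'
      obtain ⟨y, hy⟩ := hH.1
      have hy1 := (hH.mem_iff_gauge hp).1 hy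
      refine ⟨y + ((1 - gauge p H' (y - p)) / gauge p H' u) • u, ?_, ?_⟩
      · rw [hH.mem_iff_gauge hp, add_sub_right_comm, map_add, map_smul, hu, hy1]
        simp
      · rw [hH'.mem_iff_gauge hp', add_sub_right_comm, map_add, map_smul, smul_eq_mul,
          div_mul_cancel₀ _ hu']
        ring
    refine le_antisymm ?_ fun x hx => ?_
    · rw [affineSpan_le]
      rintro x (rfl | ⟨hx, hx'⟩)
      · exact AffineSubspace.self_mem_mk' _ _
      · rw [SetLike.mem_coe, AffineSubspace.mem_mk', LinearMap.mem_ker, LinearMap.sub_apply,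
          vsub_eq_sub, (hH.mem_iff_gauge hp).1 hx, (hH'.mem_iff_gauge hp').1 hx', sub_self]
    · rw [AffineSubspace.mem_mk', LinearMap.mem_ker, LinearMap.sub_apply, vsub_eq_sub,
        sub_eq_zero] at hx
      set S := affineSpan ℝ (insert p ((H : Set E) ∩ (H' : Set E))) with hS
      have hpS : p ∈ S := subset_affineSpan ℝ _ (Set.mem_insert _ _)
      have hHS : ∀ z, z ∈ H → z ∈ H' → z ∈ S := fun z h h' =>
        subset_affineSpan ℝ _ (Set.mem_insert_of_mem _ ⟨h, h'⟩)
      have hxp : x = (x - p) +ᵥ p := by simp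
      rw [hxp, AffineSubspace.vadd_mem_iff_mem_direction _ hpS]
      by_cases ht : gauge p H (x - p) = 0
      · -- translate a common point of the two hyperplanes by `x - p`
        obtain ⟨z, hz, hz'⟩ := hmeet
        have h1 : z + (x - p) ∈ S := by
          refine hHS _ ?_ ?_
          · rw [hH.mem_iff_gauge hp, add_sub_right_comm, map_add, ht,
              (hH.mem_iff_gauge hp).1 hz, add_zero]
          · rw [hH'.mem_iff_gauge hp', add_sub_right_comm, map_add, ← hx, ht,
              (hH'.mem_iff_gauge hp').1 hz', add_zero]
        have := AffineSubspace.vsub_mem_direction h1 (hHS z hz hz')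
        simpa using this
      · -- the line from `p` to `x` meets both hyperplanes in the same point
        have h1 : p + (gauge p H (x - p))⁻¹ • (x - p) ∈ S := by
          refine hHS _ ?_ ?_
          · rw [hH.mem_iff_gauge hp, add_sub_cancel_left, map_smul, smul_eq_mul,
              inv_mul_cancel₀ ht]
          · rw [hH'.mem_iff_gauge hp', add_sub_cancel_left, map_smul, smul_eq_mul, ← hx,
              inv_mul_cancel₀ ht]
        have h2 := AffineSubspace.vsub_mem_direction h1 hpS
        rw [vsub_eq_sub, add_sub_cancel_left] at h2
        exact (S.direction.smul_mem_iff (inv_ne_zero ht)).1 h2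

/-- The ordered pairs of distinct elements of `ι`. -/
abbrev OffDiag (ι : Type*) : Type _ := {e : ι × ι // e.1 ≠ e.2}

/-- The functionals defining the valid order arrangement. -/
noncomputable def voForm (A : Finset (AffineSubspace ℝ E)) (p : E) (e : OffDiag A) : Dual ℝ E :=
  gauge p (e.1.1 : AffineSubspace ℝ E) - gauge p (e.1.2 : AffineSubspace ℝ E)

theorem vo_eq_centralArrangement [Fintype (OffDiag A)] (hA : IsArrangement A)
    (hp : ∀ H ∈ A, p ∉ H) :
    vo A p = centralArrangement (voForm A p) p := by
  ext X
  simp only [vo, centralArrangement, Finset.mem_image, Finset.mem_filter, Finset.mem_product,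
    Finset.mem_univ, true_and, Prod.exists, Subtype.exists]
  constructor
  · rintro ⟨H, H', ⟨⟨hH, hH'⟩, hne⟩, rfl⟩
    exact ⟨H, hH, H', hH', fun h => hne (congrArg Subtype.val h),
      (voHyperplane_eq_mk' (hA H hH) (hA H' hH') (hp H hH) (hp H' hH') hne).symm⟩
  · rintro ⟨H, hH, H', hH', hne, rfl⟩
    have hne' : H ≠ H' := fun h => hne (Subtype.ext h)
    exact ⟨H, H', ⟨⟨hH, hH'⟩, hne'⟩,
      voHyperplane_eq_mk' (hA H hH) (hA H' hH') (hp H hH) (hp H' hH') hne'⟩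

end ValidOrder

/-! ### Valid orderings as sign patterns -/

theorem exists_sorted_list {α : Type*} (A : Finset α) (c : α → ℝ)
    (hc : ∀ H ∈ A, ∀ H' ∈ A, H ≠ H' → c H ≠ c H') :
    ∃ l : List α, l.Nodup ∧ (∀ H, H ∈ l ↔ H ∈ A) ∧
      l.Pairwise fun H H' => c H' < c H := by
  classical
  let r : α → α → Prop := fun H H' => c H' ≤ c H
  have : Std.Total r := ⟨fun a b => le_total _ _⟩
  have : IsTrans _ r := ⟨fun a b c h h' => le_trans h' h⟩
  have hnd : (A.toList.insertionSort r).Nodup :=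
    (List.perm_insertionSort r _).nodup_iff.2 A.nodup_toList
  have hmem : ∀ H, H ∈ A.toList.insertionSort r ↔ H ∈ A := fun H => by
    rw [List.mem_insertionSort, Finset.mem_toList]
  refine ⟨_, hnd, hmem, ?_⟩
  have h1 := (List.pairwise_insertionSort r A.toList).and hnd
  refine h1.imp_of_mem fun {H H'} hH hH' h => lt_of_le_of_ne h.1 ?_
  exact hc _ ((hmem _).1 hH') _ ((hmem _).1 hH) h.2.symm

section Orderings

variable {E : Type*} [AddCommGroup E] [Module ℝ E] [FiniteDimensional ℝ E] {p u : E}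
  {A : Finset (AffineSubspace ℝ E)} {l : List (AffineSubspace ℝ E)}

/-- Passing through infinity, the points of a line through `p` are met in the order of decreasing
inverse parameter. -/
theorem exists_reachedBefore_iff {a b : ℝ} :
    (∃ s t : ℝ, s * a = 1 ∧ t * b = 1 ∧ ReachedBefore s t) ↔ a ≠ 0 ∧ b ≠ 0 ∧ b < a := by
  have key : ∀ {s t : ℝ}, s ≠ 0 → t ≠ 0 → (ReachedBefore s t ↔ t⁻¹ < s⁻¹) := by
    intro s t hs ht
    rcases lt_or_gt_of_ne hs with hs | hs <;> rcases lt_or_gt_of_ne ht with ht | ht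
    · rw [inv_lt_inv_of_neg ht hs]
      simp [ReachedBefore, hs.not_gt, ht]
    · have := (inv_lt_zero.2 hs).trans (inv_pos.2 ht)
      simp [ReachedBefore, hs.not_gt, ht.not_gt, this.not_gt]
    · have := (inv_lt_zero.2 ht).trans (inv_pos.2 hs)
      simp [ReachedBefore, hs, ht, this]
    · rw [inv_lt_inv₀ ht hs]
      simp [ReachedBefore, hs, ht.not_gt]
  constructor
  · rintro ⟨s, t, hs, ht, h⟩
    have hs0 : s ≠ 0 := left_ne_zero_of_mul_eq_one hs
    have ht0 : t ≠ 0 := left_ne_zero_of_mul_eq_one ht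
    refine ⟨right_ne_zero_of_mul_eq_one hs, right_ne_zero_of_mul_eq_one ht, ?_⟩
    rw [eq_inv_of_mul_eq_one_right hs, eq_inv_of_mul_eq_one_right ht]
    exact (key hs0 ht0).1 h
  · rintro ⟨ha, hb, h⟩
    refine ⟨a⁻¹, b⁻¹, inv_mul_cancel₀ ha, inv_mul_cancel₀ hb,
      (key (inv_ne_zero ha) (inv_ne_zero hb)).2 ?_⟩
    rwa [inv_inv, inv_inv]

theorem isAdmissibleDirection_iff (hA : IsArrangement A) (hp : ∀ H ∈ A, p ∉ H) :
    IsAdmissibleDirection A p u ↔ u ≠ 0 ∧ (∀ H ∈ A, gauge p H u ≠ 0) ∧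
      ∀ H ∈ A, ∀ H' ∈ A, H ≠ H' → gauge p H u ≠ gauge p H' u := by
  have hmem : ∀ H ∈ A, ∀ t : ℝ, p + t • u ∈ H ↔ t * gauge p H u = 1 := fun H hH t => by
    rw [(hA H hH).mem_iff_gauge (hp H hH), add_sub_cancel_left, map_smul, smul_eq_mul]
  rw [IsAdmissibleDirection]
  refine and_congr_right fun _ => ?_
  have h1 : (∀ H ∈ A, u ∉ H.direction) ↔ ∀ H ∈ A, gauge p H u ≠ 0 :=
    forall₂_congr fun H hH => by rw [(hA H hH).mem_direction_iff_gauge (hp H hH)]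
  rw [h1]
  refine and_congr_right fun h0 => forall₂_congr fun H hH => forall₂_congr fun H' hH' =>
    imp_congr_right fun _ => ?_
  constructor
  · intro h he
    refine h (gauge p H u)⁻¹ ⟨(hmem H hH _).2 (inv_mul_cancel₀ (h0 H hH)), ?_⟩
    rw [hmem H' hH', he, inv_mul_cancel₀ (h0 H' hH')]
  · rintro h t ⟨h2, h3⟩
    rw [hmem H hH] at h2
    rw [hmem H' hH', ← h2] at h3
    exact h (mul_left_cancel₀ (left_ne_zero_of_mul_eq_one h2) h3).symm

/-- A valid ordering lists the hyperplanes by decreasing value of the normalized normals. -/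
theorem isValidOrdering_iff (hA : IsArrangement A) (hp : ∀ H ∈ A, p ∉ H) :
    IsValidOrdering A p l ↔ l.Nodup ∧ (∀ H, H ∈ l ↔ H ∈ A) ∧
      ∃ u : E, IsAdmissibleDirection A p u ∧
        l.Pairwise fun H H' => gauge p H' u < gauge p H u := by
  refine and_congr_right fun _ => and_congr_right fun hl => exists_congr fun u =>
    and_congr_right fun hu => List.Pairwise.iff_of_mem fun {H H'} hH hH' => ?_
  rw [hl] at hH hH'
  have h0 := ((isAdmissibleDirection_iff hA hp).1 hu).2.1
  have hmem : ∀ H ∈ A, ∀ t : ℝ, p + t • u ∈ H ↔ t * gauge p H u = 1 := fun H hH t => by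
    rw [(hA H hH).mem_iff_gauge (hp H hH), add_sub_cancel_left, map_smul, smul_eq_mul]
  simp only [hmem H hH, hmem H' hH']
  rw [exists_reachedBefore_iff]
  exact ⟨fun h => h.2.2, fun h => ⟨h0 H hH, h0 H' hH', h⟩⟩

/-- The sign pattern of a vector on which no form of the valid order arrangement vanishes is
realized by an admissible direction. -/
theorem exists_isAdmissibleDirection [Nontrivial E] (hA : IsArrangement A)
    (hp : ∀ H ∈ A, p ∉ H) (hu : ∀ e, voForm A p e u ≠ 0) :
    ∃ v, IsAdmissibleDirection A p v ∧ ∀ e, (0 < voForm A p e v ↔ 0 < voForm A p e u) := by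
  classical
  obtain ⟨x, hx⟩ := exists_ne (0 : E)
  obtain ⟨ψ, hψ⟩ : ∃ ψ : Dual ℝ E, ψ ≠ 0 := by
    obtain ⟨ψ, hψ⟩ := Module.exists_dual_forall_apply_ne_zero (K := ℝ) (fun _ : Unit => x)
      fun _ => hx
    exact ⟨ψ, fun h => hψ () (by simp [h])⟩
  -- an auxiliary nonzero functional ensures `v ≠ 0` when `A` is empty
  let G : Option A → Dual ℝ E := fun o => o.elim ψ fun H => gauge p H.1
  have hG : ∀ o, ∃ x, G o x ≠ 0 := by
    rintro (_ | H)
    · exact DFunLike.ne_iff.1 hψ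
    · exact DFunLike.ne_iff.1 ((hA H.1 H.2).gauge_ne_zero (hp H.1 H.2))
  obtain ⟨w, hw⟩ := Module.Dual.exists_forall_ne_zero_of_forall_exists G hG
  obtain ⟨δ, hδ, hh⟩ := exists_perturbation (voForm A p) Finset.univ (fun e _ => hu e) w
  have hfin : (⋃ o, {ε : ℝ | G o (u + ε • w) = 0}).Finite := by
    refine Set.finite_iUnion fun o => Set.Subsingleton.finite fun ε hε ε' hε' => ?_
    simp only [Set.mem_ofPred_eq, map_add, map_smul, smul_eq_mul] at hε hε'
    exact mul_right_cancel₀ (hw o) (by linarith)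
  obtain ⟨ε, hε, hεG⟩ := (Set.Ioo_infinite hδ).exists_notMem_finite hfin
  simp only [Set.mem_iUnion, Set.mem_ofPred_eq, not_exists] at hεG
  have h1 := hh ε (by rw [abs_of_pos hε.1]; exact hε.2)
  refine ⟨u + ε • w, (isAdmissibleDirection_iff hA hp).2 ⟨fun h => ?_, fun H hH => ?_,
    fun H hH H' hH' hne h => ?_⟩, fun e => (h1 e (Finset.mem_univ _)).2⟩
  · exact hεG none (by rw [h, map_zero])
  · exact hεG (some ⟨H, hH⟩)
  · refine (h1 ⟨(⟨H, hH⟩, ⟨H', hH'⟩), fun h => hne (congrArg Subtype.val h)⟩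
      (Finset.mem_univ _)).1 ?_
    rw [voForm, LinearMap.sub_apply, h, sub_self]

/-- Valid orderings correspond to the regions of the valid order arrangement. -/
theorem numValidOrderings_eq_ncard_signPatterns [Nontrivial E] [Fintype (OffDiag A)]
    (hA : IsArrangement A) (hp : ∀ H ∈ A, p ∉ H) :
    numValidOrderings A p = (signPatterns (voForm A p) Finset.univ).ncard := by
  classical
  have hval : ∀ l, IsValidOrdering A p l → ∃ u, IsAdmissibleDirection A p u ∧
      l.Pairwise fun H H' => gauge p H' u < gauge p H u := fun l hl =>
    ((isValidOrdering_iff hA hp).1 hl).2.2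
  have hlt : ∀ (e : OffDiag A) (u : E), 0 < voForm A p e u ↔
      gauge p (e.1.2 : AffineSubspace ℝ E) u < gauge p (e.1.1 : AffineSubspace ℝ E) u :=
    fun e u => by rw [voForm, LinearMap.sub_apply, sub_pos]
  -- two vectors that order a list of all hyperplanes in the same way have the same sign pattern
  have hsame : ∀ (l : List (AffineSubspace ℝ E)) (u v : E), (∀ H, H ∈ l ↔ H ∈ A) →
      (l.Pairwise fun H H' => gauge p H' u < gauge p H u) →
      (l.Pairwise fun H H' => gauge p H' v < gauge p H v) →
      ∀ e, (0 < voForm A p e u ↔ 0 < voForm A p e v) := by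
    intro l u v hl h1 h2 e
    have h3 := (h1.and h2).imp (S := fun H H' =>
      gauge p H' u < gauge p H u ↔ gauge p H' v < gauge p H v) fun h => iff_of_true h.1 h.2
    have h4 := (h1.and h2).imp (S := fun H H' =>
      gauge p H u < gauge p H' u ↔ gauge p H v < gauge p H' v)
      fun h => iff_of_false h.1.not_gt h.2.not_gt
    have : Std.Symm fun H H' =>
        ((gauge p H' u < gauge p H u ↔ gauge p H' v < gauge p H v) ∧
          (gauge p H u < gauge p H' u ↔ gauge p H v < gauge p H' v)) :=
      ⟨fun _ _ h => ⟨h.2, h.1⟩⟩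
    rw [hlt, hlt]
    exact ((h3.and h4).forall ((hl _).2 e.1.1.2) ((hl _).2 e.1.2.2) fun h => e.2 (Subtype.ext h)).1
  refine Set.ncard_congr
    (fun l hl => {e | e ∈ Finset.univ ∧ 0 < voForm A p e (hval l hl).choose}) ?_ ?_ ?_
  · intro l hl
    have h1 := (isAdmissibleDirection_iff hA hp).1 (hval l hl).choose_spec.1
    refine ⟨_, fun e _ => ?_, rfl⟩
    rw [voForm, LinearMap.sub_apply]
    exact sub_ne_zero.2 (h1.2.2 _ e.1.1.2 _ e.1.2.2 fun h => e.2 (Subtype.ext h))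
  · intro l l' hl hl' h
    have h1 := (isValidOrdering_iff hA hp).1 hl
    have h2 := (isValidOrdering_iff hA hp).1 hl'
    have h3 := (hval l hl).choose_spec.2
    have h4 := (hval l' hl').choose_spec.2
    set u := (hval l hl).choose
    set v := (hval l' hl').choose
    have h5 : l'.Pairwise fun H H' => gauge p H' u < gauge p H u := by
      refine (h4.and h2.1).imp_of_mem fun {H H'} hH hH' hlt' => ?_
      have h6 := Set.ext_iff.1 h ⟨(⟨H, (h2.2.1 H).1 hH⟩, ⟨H', (h2.2.1 H').1 hH'⟩),
        fun h => hlt'.2 (congrArg Subtype.val h)⟩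
      simp only [Finset.mem_univ, true_and, Set.mem_ofPred_eq, hlt] at h6
      exact h6.2 hlt'.1
    refine List.Perm.eq_of_pairwise (fun H H' _ _ h h' => absurd h' h.not_gt) h3 h5 ?_
    exact (List.perm_ext_iff_of_nodup h1.1 h2.1).2 fun H => (h1.2.1 H).trans (h2.2.1 H).symm
  · rintro _ ⟨u, hu, rfl⟩
    obtain ⟨v, hv, huv⟩ := exists_isAdmissibleDirection hA hp fun e => hu e (Finset.mem_univ e)
    obtain ⟨l, hnd, hmem, hpw⟩ := exists_sorted_list A (fun H => gauge p H v)
      ((isAdmissibleDirection_iff hA hp).1 hv).2.2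
    have hl : IsValidOrdering A p l := (isValidOrdering_iff hA hp).2 ⟨hnd, hmem, v, hv, hpw⟩
    refine ⟨l, hl, ?_⟩
    ext e
    refine and_congr_right fun _ => ?_
    rw [← huv]
    exact hsame l _ _ hmem (hval l hl).choose_spec.2 hpw e

end Orderings


/-! ### The Dilworth truncation -/

section Dilworth

variable {ι κ W W' : Type*} [AddCommGroup W] [Module ℝ W] [AddCommGroup W'] [Module ℝ W']

/-- Independence of a set of pairs in the Dilworth truncation of the matroid of the vectors `φ i`:
every nonempty set `S` of pairs touches vectors of rank at least `#S + 1`. -/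
def DilworthIndep (φ : ι → W) (T : Set (OffDiag ι)) : Prop :=
  ∀ S : Finset (OffDiag ι), ↑S ⊆ T → S.Nonempty →
    S.card + 1 ≤ finrank ℝ (span ℝ
      ((fun e : OffDiag ι => φ e.1.1) '' S ∪ (fun e : OffDiag ι => φ e.1.2) '' S))

theorem dilworthIndep_congr [Finite ι] {φ : ι → W} {φ' : ι → W'}
    (h : ∀ S : Set ι, LinearIndepOn ℝ φ S ↔ LinearIndepOn ℝ φ' S) (T : Set (OffDiag ι)) :
    DilworthIndep φ T ↔ DilworthIndep φ' T := by
  refine forall₃_congr fun S _ _ => ?_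
  have key := finrank_span_image_eq_of_linearIndepOn_iff h
    ((fun e : OffDiag ι => e.1.1) '' (S : Set (OffDiag ι)) ∪
      (fun e : OffDiag ι => e.1.2) '' (S : Set (OffDiag ι)))
  rw [Set.image_union, Set.image_union, Set.image_image, Set.image_image, Set.image_image,
    Set.image_image] at key
  rw [key]

/-- The bijection of pairs induced by a bijection. -/
def offDiagCongr (σ : ι ≃ κ) : OffDiag ι ≃ OffDiag κ :=
  (σ.prodCongr σ).subtypeEquiv fun e => by simp

theorem DilworthIndep.image {φ : κ → W} {σ : ι ≃ κ} {T : Set (OffDiag ι)}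
    (h : DilworthIndep (φ ∘ σ) T) : DilworthIndep φ (offDiagCongr σ '' T) := by
  intro S hS hS0
  have key := h (S.map (offDiagCongr σ).symm.toEmbedding) (by
    rw [Finset.coe_map]
    rintro _ ⟨e, he, rfl⟩
    obtain ⟨f, hf, rfl⟩ := hS he
    simpa using hf) (by simpa using hS0)
  have h1 : (fun e : OffDiag ι => (φ ∘ σ) e.1.1) '' (S.map (offDiagCongr σ).symm.toEmbedding) =
      (fun e : OffDiag κ => φ e.1.1) '' S := by
    rw [Finset.coe_map, Set.image_image]
    exact Set.image_congr fun e _ => by simp [offDiagCongr]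
  have h2 : (fun e : OffDiag ι => (φ ∘ σ) e.1.2) '' (S.map (offDiagCongr σ).symm.toEmbedding) =
      (fun e : OffDiag κ => φ e.1.2) '' S := by
    rw [Finset.coe_map, Set.image_image]
    exact Set.image_congr fun e _ => by simp [offDiagCongr]
  rwa [Finset.card_map, h1, h2] at key

theorem dilworthIndep_image_iff {φ : κ → W} {σ : ι ≃ κ} {T : Set (OffDiag ι)} :
    DilworthIndep φ (offDiagCongr σ '' T) ↔ DilworthIndep (φ ∘ σ) T := by
  refine ⟨fun h => ?_, DilworthIndep.image⟩
  have h1 : φ = (φ ∘ σ) ∘ σ.symm := by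
    ext
    simp
  rw [h1] at h
  have h2 := h.image
  have h3 : offDiagCongr σ.symm = (offDiagCongr σ).symm := rfl
  rwa [h3, Equiv.symm_image_image] at h2

end Dilworth

/-! ### Sections at a generic point -/

section Crossing

variable {ι V : Type*} [AddCommGroup V] [Module ℝ V]

/-- The combination of the functionals `φ i` and `φ j` that vanishes at `x`: for `x` in general
position it spans the section of the plane of `φ i` and `φ j` by the hyperplane `{g | g x = 0}`. -/
noncomputable def crossing (φ : ι → Dual ℝ V) (x : V) (e : OffDiag ι) : Dual ℝ V :=
  φ e.1.2 x • φ e.1.1 - φ e.1.1 x • φ e.1.2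

/-- The crossings of the pairs in `S` lie in a proper subspace of the span of the functionals that
`S` touches. -/
theorem DilworthIndep.of_linearIndepOn_crossing [FiniteDimensional ℝ V] [Finite ι]
    {φ : ι → Dual ℝ V} {x : V} (hx : ∀ i, φ i x ≠ 0) {T : Set (OffDiag ι)}
    (h : LinearIndepOn ℝ (crossing φ x) T) : DilworthIndep φ T := by
  intro S hS hS0
  have h1 := finrank_span_image_of_linearIndepOn (h.mono hS)
  rw [Set.ncard_coe_finset] at h1
  rw [← h1, Nat.add_one_le_iff]
  refine Submodule.finrank_lt_finrank_of_lt (lt_of_le_of_lt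
    (b := span ℝ ((fun e : OffDiag ι => φ e.1.1) '' S ∪ (fun e : OffDiag ι => φ e.1.2) '' S) ⊓
      (Dual.eval ℝ V x).ker) ?_ ?_)
  · rw [span_le]
    rintro _ ⟨e, he, rfl⟩
    refine ⟨Submodule.sub_mem _ (Submodule.smul_mem _ _ (subset_span (Or.inl ⟨e, he, rfl⟩)))
      (Submodule.smul_mem _ _ (subset_span (Or.inr ⟨e, he, rfl⟩))), ?_⟩
    simp [crossing, mul_comm]
  · refine lt_of_le_of_ne inf_le_left fun heq => ?_
    obtain ⟨e, he⟩ := hS0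
    have h2 := inf_eq_left.1 heq (subset_span (Or.inl ⟨e, he, rfl⟩))
    exact hx _ h2

/-- The value of an affine functional as a polynomial in the coordinates of the point. -/
noncomputable def affinePolynomial {d : ℕ} (φ : Dual ℝ ((Fin d → ℝ) × ℝ)) :
    MvPolynomial (Fin d) ℝ :=
  ∑ k, MvPolynomial.C (φ (Pi.single k 1, 0)) * MvPolynomial.X k + MvPolynomial.C (φ (0, 1))

theorem eval_affinePolynomial {d : ℕ} (φ : Dual ℝ ((Fin d → ℝ) × ℝ)) (p : Fin d → ℝ) :
    MvPolynomial.eval p (affinePolynomial φ) = φ (p, 1) := by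
  have h1 : (p, (1 : ℝ)) = LinearMap.inl ℝ (Fin d → ℝ) ℝ p + (0, 1) := by simp
  have h2 : LinearMap.inl ℝ (Fin d → ℝ) ℝ p =
      ∑ k, p k • LinearMap.inl ℝ (Fin d → ℝ) ℝ (Pi.single k 1) := by
    simp_rw [← map_smul, ← map_sum, ← Pi.single_smul, smul_eq_mul, mul_one]
    rw [Finset.univ_sum_single]
  rw [h1, map_add, h2, map_sum]
  simp_rw [map_smul]
  simp [affinePolynomial, mul_comm]

/-- The hyperplane of Lovász's theorem is made to avoid the last coordinate functional, so that it
consists of the functionals vanishing at a point of the form `(p, 1)`. -/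
theorem exists_linearIndepOn_crossing {d : ℕ} {φ : ι → Dual ℝ ((Fin d → ℝ) × ℝ)}
    {T : Finset (OffDiag ι)} (hT : DilworthIndep φ (T : Set (OffDiag ι))) :
    ∃ p : Fin d → ℝ, LinearIndepOn ℝ (crossing φ (p, 1)) (T : Set (OffDiag ι)) := by
  obtain ⟨P, hPZ, hP⟩ := exists_dual_linearIndepOn_section T
    (fun e : OffDiag ι => φ e.1.1) (fun e => φ e.1.2) {LinearMap.snd ℝ (Fin d → ℝ) ℝ}
    (Set.finite_singleton _) (by
      rintro _ rfl h
      have := LinearMap.congr_fun h (0, 1)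
      simp at this) fun S hS hS0 => hT S (by exact_mod_cast hS) hS0
  obtain ⟨⟨x, y⟩, rfl⟩ := (Module.evalEquiv ℝ ((Fin d → ℝ) × ℝ)).surjective P
  have hy : y ≠ 0 := hPZ _ rfl
  refine ⟨y⁻¹ • x, ?_⟩
  have h1 : ∀ i, φ i (y⁻¹ • x, 1) = y⁻¹ * φ i (x, y) := fun i => by
    rw [← smul_eq_mul, ← map_smul, Prod.smul_mk, smul_eq_mul, inv_mul_cancel₀ hy]
  have h2 : crossing φ (y⁻¹ • x, 1) = fun e => y⁻¹ • crossing φ (x, y) e := by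
    ext1 e
    rw [crossing, crossing, h1, h1, mul_smul, mul_smul, smul_sub]
  rw [h2]
  exact LinearIndependent.units_smul hP fun _ => Units.mk0 _ (inv_ne_zero hy)

/-- Independence of crossings holds on a Zariski open set of points, so it holds generically once
it holds at one point, which Lovász's theorem provides. -/
theorem exists_polynomial_linearIndepOn_crossing {d : ℕ} (φ : ι → Dual ℝ ((Fin d → ℝ) × ℝ))
    (T : Finset (OffDiag ι)) : ∃ g : MvPolynomial (Fin d) ℝ, g ≠ 0 ∧
      (DilworthIndep φ (T : Set (OffDiag ι)) → ∀ p : Fin d → ℝ, MvPolynomial.eval p g ≠ 0 →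
        LinearIndepOn ℝ (crossing φ (p, 1)) (T : Set (OffDiag ι))) := by
  classical
  by_cases hT : DilworthIndep φ (T : Set (OffDiag ι))
  swap
  · exact ⟨1, one_ne_zero, fun h => absurd h hT⟩
  obtain ⟨p₀, hp₀⟩ := exists_linearIndepOn_crossing hT
  -- a left inverse of the map sending the basis vector of `e` to the crossing of `e` at `p₀`
  have hinj : (Fintype.linearCombination ℝ
      fun e : (T : Set (OffDiag ι)) => crossing φ (p₀, 1) e).ker = ⊥ :=
    LinearMap.ker_eq_bot.2 (linearIndependent_iff_injective_fintypeLinearCombination.1 hp₀)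
  obtain ⟨Λ, hΛ⟩ := LinearMap.exists_leftInverse_of_injective _ hinj
  have hΛ0 : ∀ e : (T : Set (OffDiag ι)), Λ (crossing φ (p₀, 1) e) = Pi.single e 1 := fun e => by
    have := LinearMap.congr_fun hΛ (Pi.single e 1)
    simpa [Fintype.linearCombination_apply_single] using this
  let M : Matrix (T : Set (OffDiag ι)) (T : Set (OffDiag ι)) (MvPolynomial (Fin d) ℝ) :=
    Matrix.of fun e f =>
      affinePolynomial (φ e.1.1.2) * MvPolynomial.C (Λ (φ e.1.1.1) f) -
        affinePolynomial (φ e.1.1.1) * MvPolynomial.C (Λ (φ e.1.1.2) f)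
  have hM : ∀ p : Fin d → ℝ, MvPolynomial.eval p M.det =
      (Matrix.of fun e f : (T : Set (OffDiag ι)) => Λ (crossing φ (p, 1) e) f).det := fun p => by
    rw [RingHom.map_det]
    congr 1
    ext e f
    simp [M, eval_affinePolynomial, crossing]
  refine ⟨M.det, fun h0 => ?_, fun _ p hp => ?_⟩
  · have h1 := hM p₀
    rw [h0, map_zero] at h1
    have h2 : (Matrix.of fun e f : (T : Set (OffDiag ι)) => Λ (crossing φ (p₀, 1) e) f) = 1 := by
      ext e f
      rw [Matrix.of_apply, hΛ0, Matrix.one_apply, Pi.single_apply]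
      simp [eq_comm]
    rw [h2, Matrix.det_one] at h1
    exact zero_ne_one h1
  · rw [hM] at hp
    exact LinearIndependent.of_comp Λ (Matrix.linearIndependent_rows_of_det_ne_zero hp)

/-- A polynomial outside whose zero set the independent sets of crossings are those of the
Dilworth truncation. -/
theorem exists_polynomial_forall_linearIndepOn_crossing [Finite ι] {d : ℕ}
    (φ : ι → Dual ℝ ((Fin d → ℝ) × ℝ)) : ∃ g : MvPolynomial (Fin d) ℝ, g ≠ 0 ∧
      ∀ p : Fin d → ℝ, MvPolynomial.eval p g ≠ 0 → (∀ i, φ i (p, 1) ≠ 0) →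
        ∀ T : Set (OffDiag ι), LinearIndepOn ℝ (crossing φ (p, 1)) T ↔ DilworthIndep φ T := by
  classical
  have := Fintype.ofFinite ι
  choose g hg0 hg using exists_polynomial_linearIndepOn_crossing φ
  refine ⟨∏ T, g T, Finset.prod_ne_zero_iff.2 fun T _ => hg0 T, fun p hp hφ T =>
    ⟨DilworthIndep.of_linearIndepOn_crossing hφ, fun h => ?_⟩⟩
  rw [map_prod, Finset.prod_ne_zero_iff] at hp
  have := hg T.toFinset (by simpa using h) p (hp _ (Finset.mem_univ _))
  simpa using this

end Crossing

section Gauge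

variable {E : Type*} [AddCommGroup E] [Module ℝ E] [FiniteDimensional ℝ E] {p : E}
  {A : Finset (AffineSubspace ℝ E)}

/-- A functional vanishing at `(p, 1)` is determined by its restriction to `E`. -/
theorem injOn_dualMap_inl {E : Type*} [AddCommGroup E] [Module ℝ E] {p : E}
    {U : Submodule ℝ (Dual ℝ (E × ℝ))} (hU : U ≤ (Dual.eval ℝ (E × ℝ) (p, 1)).ker) :
    Set.InjOn (LinearMap.inl ℝ E ℝ).dualMap U := by
  refine LinearMap.injOn_of_disjoint_ker subset_rfl (disjoint_def.2 fun g hg hg0 => ?_)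
  have h1 : g (p, 1) = 0 := hU hg
  have h2 : ∀ x, g (x, 0) = 0 := fun x => LinearMap.congr_fun hg0 x
  refine LinearMap.ext fun ⟨x, y⟩ => ?_
  have h3 : ((x, y) : E × ℝ) = (x - y • p, 0) + y • (p, 1) := by simp
  rw [h3, map_add, map_smul, h1, h2]
  simp

/-- The normals of the valid order arrangement have the same independent sets as the crossings at
`(p, 1)` of the equations of the hyperplanes. -/
theorem linearIndepOn_voForm_iff (hp : ∀ H : A, equation (H : AffineSubspace ℝ E) (p, 1) ≠ 0)
    (T : Set (OffDiag A)) : LinearIndepOn ℝ (voForm A p) T ↔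
      LinearIndepOn ℝ (crossing (fun H : A => equation (H : AffineSubspace ℝ E)) (p, 1)) T := by
  set φ := fun H : A => equation (H : AffineSubspace ℝ E) with hφ
  set ρ := (LinearMap.inl ℝ E ℝ).dualMap with hρ
  have hinj : Set.InjOn ρ (span ℝ (crossing φ (p, 1) '' T)) := by
    refine injOn_dualMap_inl (p := p) ?_
    rw [span_le]
    rintro _ ⟨e, -, rfl⟩
    simp [crossing, mul_comm]
  rw [← LinearMap.linearIndepOn_iff_of_injOn ρ hinj]
  have hc : ∀ e : OffDiag A, -(φ e.1.1 (p, 1))⁻¹ * (φ e.1.2 (p, 1))⁻¹ ≠ 0 := fun e =>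
    mul_ne_zero (neg_ne_zero.2 (inv_ne_zero (hp _))) (inv_ne_zero (hp _))
  have hvo : voForm A p = fun e => (-(φ e.1.1 (p, 1))⁻¹ * (φ e.1.2 (p, 1))⁻¹) •
      ρ (crossing φ (p, 1) e) := by
    ext1 e
    have h1 : φ e.1.1 (p, 1) ≠ 0 := hp e.1.1
    have h2 : φ e.1.2 (p, 1) ≠ 0 := hp e.1.2
    have h3 : ∀ H : A, ρ (φ H) = normal (H : AffineSubspace ℝ E) := fun _ => rfl
    rw [crossing, map_sub, map_smul, map_smul, h3, h3, voForm, gauge, gauge, smul_sub, smul_smul,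
      smul_smul, sub_eq_sub_iff_add_eq_add]
    have h4 : -(φ e.1.1 (p, 1))⁻¹ * (φ e.1.2 (p, 1))⁻¹ * φ e.1.2 (p, 1) =
        -(φ e.1.1 (p, 1))⁻¹ := by field_simp
    have h5 : -(φ e.1.1 (p, 1))⁻¹ * (φ e.1.2 (p, 1))⁻¹ * φ e.1.1 (p, 1) =
        -(φ e.1.2 (p, 1))⁻¹ := by field_simp
    rw [h4, h5]
  rw [hvo]
  exact LinearIndependent.units_smul_iff (fun e : T => ρ (crossing φ (p, 1) e))
    fun e => Units.mk0 _ (hc e)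

end Gauge


/-! ### Atoms of the intersection poset -/

section Atoms

variable {E : Type*} [AddCommGroup E] [Module ℝ E] {A : Finset (AffineSubspace ℝ E)}

/-- A hyperplane of `A` as an element of the intersection poset. -/
def hyperplaneElement (hA : IsArrangement A) (H : A) : IntersectionPoset A :=
  OrderDual.toDual ⟨H.1, mem_intersections.2
    ⟨⟨{H.1}, Finset.singleton_subset_iff.2 H.2, Finset.inf_singleton⟩, (hA H.1 H.2).1⟩⟩

theorem exists_le_of_ne_whole {x : IntersectionPoset A} (hx : x ≠ whole A) :
    ∃ K ∈ A, (OrderDual.ofDual x).1 ≤ K := by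
  obtain ⟨⟨S, hSA, hS⟩, -⟩ := mem_intersections.1 (OrderDual.ofDual x).2
  rcases S.eq_empty_or_nonempty with rfl | ⟨K, hK⟩
  · exact absurd (OrderDual.ofDual.injective (Subtype.ext hS.symm)) hx
  · exact ⟨K, hSA hK, hS ▸ Finset.inf_le hK⟩

variable [FiniteDimensional ℝ E]

theorem IsHyperplane.eq_of_le {H K : AffineSubspace ℝ E} (hH : IsHyperplane H)
    (hK : IsHyperplane K) (h : H ≤ K) : H = K := by
  refine AffineSubspace.ext_of_direction_eq (Submodule.eq_of_le_of_finrank_eq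
    (AffineSubspace.direction_le h) ?_) ?_
  · have h1 := hH.2
    have h2 := hK.2
    omega
  · obtain ⟨x, hx⟩ := hH.1
    exact ⟨x, hx, h hx⟩

theorem mem_iff_whole_covBy (hA : IsArrangement A) (x : IntersectionPoset A) :
    (OrderDual.ofDual x).1 ∈ A ↔ whole A ⋖ x := by
  have key : ∀ x : IntersectionPoset A, (OrderDual.ofDual x).1 ∈ A → whole A ⋖ x := by
    intro x hx
    refine ⟨lt_of_le_of_ne (whole_le x) ?_, fun z hz hzx => ?_⟩
    · rintro rfl
      have h1 : finrank ℝ (⊤ : AffineSubspace ℝ E).direction + 1 = finrank ℝ E := (hA _ hx).2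
      rw [AffineSubspace.direction_top, finrank_top] at h1
      omega
    · obtain ⟨K, hK, hzK⟩ := exists_le_of_ne_whole hz.ne'
      have hxz : (OrderDual.ofDual x).1 ≤ (OrderDual.ofDual z).1 := hzx.le
      have h1 := (hA _ hx).eq_of_le (hA K hK) (hxz.trans hzK)
      have h2 : (OrderDual.ofDual z).1 ≤ (OrderDual.ofDual x).1 := h1 ▸ hzK
      exact hzx.ne (le_antisymm hzx.le h2)
  refine ⟨key x, fun h => ?_⟩
  obtain ⟨K, hK, hxK⟩ := exists_le_of_ne_whole h.ne'
  have h1 : hyperplaneElement hA ⟨K, hK⟩ ≤ x := hxK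
  have h2 : hyperplaneElement hA ⟨K, hK⟩ = x :=
    by_contra fun hne => h.2 (key (hyperplaneElement hA ⟨K, hK⟩) hK).lt (lt_of_le_of_ne h1 hne)
  rw [← h2]
  exact hK

/-- The hyperplanes of `A` are the atoms of its intersection poset. -/
def atomEquiv (hA : IsArrangement A) : A ≃ {x : IntersectionPoset A // whole A ⋖ x} where
  toFun H := ⟨hyperplaneElement hA H, (mem_iff_whole_covBy hA _).1 H.2⟩
  invFun x := ⟨(OrderDual.ofDual x.1).1, (mem_iff_whole_covBy hA _).2 x.2⟩
  left_inv _ := rfl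
  right_inv _ := rfl

/-- An isomorphism of intersection posets restricts to a bijection of the hyperplanes. -/
theorem exists_equiv_hyperplaneElement {F : Type*} [AddCommGroup F] [Module ℝ F]
    [FiniteDimensional ℝ F] {B : Finset (AffineSubspace ℝ F)} (hA : IsArrangement A)
    (hB : IsArrangement B) (e : IntersectionPoset A ≃o IntersectionPoset B) :
    ∃ σ : A ≃ B, ∀ H, hyperplaneElement hB (σ H) = e (hyperplaneElement hA H) := by
  let e' : {x : IntersectionPoset A // whole A ⋖ x} ≃ {y : IntersectionPoset B // whole B ⋖ y} :=
    e.toEquiv.subtypeEquiv fun x => by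
      rw [← orderIso_whole e]
      exact (apply_covBy_apply_iff e).symm
  refine ⟨(atomEquiv hA).trans (e'.trans (atomEquiv hB).symm), fun H => ?_⟩
  exact congrArg Subtype.val
    ((atomEquiv hB).apply_symm_apply (e' (atomEquiv hA H)))

end Atoms

/-! ### The matroid of an arrangement from its intersection poset -/

section Irredundant

/-- A subfamily is irredundant if it is bounded above and none of its members lies below all the
upper bounds of the others. -/
def Irredundant {ι L : Type*} [LE L] (a : ι → L) (S : Set ι) : Prop :=
  (∃ x, ∀ i ∈ S, a i ≤ x) ∧ ∀ i ∈ S, ∃ x, (∀ j ∈ S, j ≠ i → a j ≤ x) ∧ ¬ a i ≤ x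

theorem exists_forall_apply_le_iff {ι L L' : Type*} [LE L] [LE L'] (e : L ≃o L') (a : ι → L)
    (S : Set ι) : (∃ x, ∀ i ∈ S, e (a i) ≤ x) ↔ ∃ x, ∀ i ∈ S, a i ≤ x := by
  rw [e.surjective.exists]
  simp

theorem irredundant_orderIso_iff {ι L L' : Type*} [LE L] [LE L'] (e : L ≃o L') (a : ι → L)
    (S : Set ι) : Irredundant (fun i => e (a i)) S ↔ Irredundant a S := by
  simp only [Irredundant, e.surjective.exists, e.le_iff_le]

variable {ι E : Type*} [Finite ι] [AddCommGroup E] [Module ℝ E]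
  {A : Finset (AffineSubspace ℝ E)} {a : ι → IntersectionPoset A}

/-- A family of hyperplanes with a common point has its intersection in the intersection poset. -/
theorem exists_forall_mem_iff (ha : ∀ i, (OrderDual.ofDual (a i)).1 ∈ A) {S : Set ι}
    (hS : ∃ x, ∀ i ∈ S, x ∈ (OrderDual.ofDual (a i)).1) :
    ∃ X : IntersectionPoset A, ∀ y, y ∈ (OrderDual.ofDual X).1 ↔
      ∀ i ∈ S, y ∈ (OrderDual.ofDual (a i)).1 := by
  classical
  have := Fintype.ofFinite ι
  have h1 : ∀ y, y ∈ (S.toFinset.image fun i => (OrderDual.ofDual (a i)).1).inf id ↔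
      ∀ i ∈ S, y ∈ (OrderDual.ofDual (a i)).1 := fun y => by
    rw [mem_finset_inf]
    simp
  refine ⟨OrderDual.toDual ⟨_, mem_intersections.2 ⟨⟨_, ?_, rfl⟩, ?_⟩⟩, h1⟩
  · intro H hH
    obtain ⟨i, -, rfl⟩ := Finset.mem_image.1 hH
    exact ha i
  · obtain ⟨x, hx⟩ := hS
    exact ⟨x, (h1 x).2 hx⟩

theorem exists_forall_le_iff_exists_mem (ha : ∀ i, (OrderDual.ofDual (a i)).1 ∈ A) (S : Set ι) :
    (∃ X, ∀ i ∈ S, a i ≤ X) ↔ ∃ x, ∀ i ∈ S, x ∈ (OrderDual.ofDual (a i)).1 := by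
  constructor
  · rintro ⟨X, hX⟩
    obtain ⟨x, hx⟩ := (mem_intersections.1 (OrderDual.ofDual X).2).2
    exact ⟨x, fun i hi => hX i hi hx⟩
  · intro h
    obtain ⟨X, hX⟩ := exists_forall_mem_iff ha h
    exact ⟨X, fun i hi y hy => (hX y).1 hy i hi⟩

/-- A set of hyperplanes is irredundant in the intersection poset if and only if it has a common
point and independent normals. -/
theorem irredundant_iff (ha : ∀ i, (OrderDual.ofDual (a i)).1 ∈ A) {α : ι → Dual ℝ E} {c : ι → ℝ}
    (hα : ∀ i x, x ∈ (OrderDual.ofDual (a i)).1 ↔ α i x = c i) (S : Set ι) :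
    Irredundant a S ↔ (∃ x, ∀ i ∈ S, α i x = c i) ∧ LinearIndepOn ℝ α S := by
  rw [Irredundant, exists_forall_le_iff_exists_mem ha]
  simp only [hα]
  refine and_congr_right fun ⟨x, hx⟩ => ?_
  rw [linearIndepOn_iff_notMem_span]
  refine forall₂_congr fun i hi => ?_
  rw [← biInf_ker_le_ker_iff, SetLike.not_le_iff_exists]
  constructor
  · rintro ⟨X, hX, hXi⟩
    obtain ⟨y, hy, hyi⟩ := SetLike.not_le_iff_exists.1
      (show ¬ (OrderDual.ofDual X).1 ≤ (OrderDual.ofDual (a i)).1 from hXi)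
    refine ⟨y - x, ?_, fun h => hyi ((hα i y).2 ?_)⟩
    · simp only [mem_iInf, LinearMap.mem_ker]
      rintro j ⟨hj, hji⟩
      rw [map_sub, (hα j y).1 (hX j hj hji hy), hx j hj, sub_self]
    · rw [LinearMap.mem_ker, map_sub, hx i hi] at h
      linarith
  · rintro ⟨u, hu, hui⟩
    simp only [mem_iInf, LinearMap.mem_ker] at hu
    obtain ⟨X, hX⟩ := exists_forall_mem_iff ha (S := S \ {i})
      ⟨x, fun j hj => (hα j x).2 (hx j hj.1)⟩
    refine ⟨X, fun j hj hji y hy => (hX y).1 hy j ⟨hj, hji⟩, fun h => hui ?_⟩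
    have h1 : x + u ∈ (OrderDual.ofDual X).1 := (hX _).2 fun j hj => by
      rw [hα, map_add, hu j hj, hx j hj.1, add_zero]
    have h2 := (hα i _).1 (h h1)
    rw [map_add, hx i hi] at h2
    rw [LinearMap.mem_ker]
    linarith

end Irredundant

section Lift

variable {ι E : Type*} [Finite ι] [AddCommGroup E] [Module ℝ E] [FiniteDimensional ℝ E]

/-- Equations with independent normals have a common solution. -/
theorem exists_forall_apply_eq {α : ι → Dual ℝ E} {S : Set ι} (h : LinearIndepOn ℝ α S)
    (c : ι → ℝ) : ∃ x, ∀ i ∈ S, α i x = c i := by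
  classical
  have := Fintype.ofFinite S
  obtain ⟨Λ, hΛ⟩ := LinearMap.exists_leftInverse_of_injective _
    (LinearMap.ker_eq_bot.2 (linearIndependent_iff_injective_fintypeLinearCombination.1 h))
  let P : Dual ℝ (Dual ℝ E) := (Fintype.linearCombination ℝ fun i : S => c i) ∘ₗ Λ
  obtain ⟨x, hx⟩ := (Module.evalEquiv ℝ E).surjective P
  refine ⟨x, fun i hi => ?_⟩
  have h1 : P (α i) = c i := by
    have h2 := LinearMap.congr_fun hΛ (Pi.single ⟨i, hi⟩ 1)
    have h3 : Λ (α i) = Pi.single ⟨i, hi⟩ 1 := by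
      simpa [Fintype.linearCombination_apply_single] using h2
    simp [P, h3, Fintype.linearCombination_apply_single]
  rw [← h1, ← hx]
  rfl

/-- Independence of the equations of a set of affine hyperplanes in terms of those of its subsets
that have a common point and independent normals: either the set itself is of this kind, or it has
no common point and becomes of this kind when one hyperplane is removed. -/
theorem linearIndepOn_iff_of_equations (φ : ι → Dual ℝ (E × ℝ)) (S : Set ι) :
    LinearIndepOn ℝ φ S ↔
      ((∃ x, ∀ i ∈ S, φ i (x, 1) = 0) ∧
        LinearIndepOn ℝ (fun i => φ i ∘ₗ LinearMap.inl ℝ E ℝ) S) ∨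
      (¬ (∃ x, ∀ i ∈ S, φ i (x, 1) = 0)) ∧ ∃ i ∈ S, (∃ x, ∀ j ∈ S \ {i}, φ j (x, 1) = 0) ∧
        LinearIndepOn ℝ (fun i => φ i ∘ₗ LinearMap.inl ℝ E ℝ) (S \ {i}) := by
  set ρ := (LinearMap.inl ℝ E ℝ).dualMap with hρ
  set α : ι → Dual ℝ E := fun i => φ i ∘ₗ LinearMap.inl ℝ E ℝ with hα
  have hαφ : ∀ T : Set ι, α '' T = ρ '' (φ '' T) := fun T => by
    rw [Set.image_image]
    rfl
  have hcentral : ∀ T : Set ι, (∃ x, ∀ i ∈ T, φ i (x, 1) = 0) →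
      (LinearIndepOn ℝ α T ↔ LinearIndepOn ℝ φ T) := by
    rintro T ⟨x, hx⟩
    refine LinearMap.linearIndepOn_iff_of_injOn ρ (injOn_dualMap_inl (p := x) ?_)
    rw [span_le]
    rintro _ ⟨i, hi, rfl⟩
    exact hx i hi
  have hsolve : ∀ T : Set ι, LinearIndepOn ℝ α T → ∃ x, ∀ i ∈ T, φ i (x, 1) = 0 := by
    intro T hT
    obtain ⟨x, hx⟩ := exists_forall_apply_eq hT fun i => -φ i (0, 1)
    refine ⟨x, fun i hi => ?_⟩
    have h1 : φ i (x, 0) = -φ i (0, 1) := hx i hi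
    have h2 : ((x, 1) : E × ℝ) = (x, 0) + (0, 1) := by simp
    rw [h2, map_add, h1, neg_add_cancel]
  by_cases hS : ∃ x, ∀ i ∈ S, φ i (x, 1) = 0
  · simp only [hS, not_true_eq_false, false_and, or_false, true_and]
    exact (hcentral S hS).symm
  simp only [hS, not_false_eq_true, false_and, false_or, true_and]
  constructor
  · intro h
    -- a linear relation among the normals puts the last coordinate into the span of the equations
    have key : ∀ T ⊆ S, ∀ i ∈ T, α i ∈ span ℝ (α '' (T \ {i})) →
        LinearMap.snd ℝ E ℝ ∈ span ℝ (φ '' T) ∧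
        ∃ g ∈ span ℝ (φ '' (T \ {i})), ∃ s : ℝ, φ i = g + s • LinearMap.snd ℝ E ℝ := by
      intro T hTS i hi hspan
      rw [hαφ, span_image] at hspan
      obtain ⟨g, hg, hgi⟩ := hspan
      have h1 : ∀ x, (φ i - g) (x, 0) = 0 := fun x => by
        have h2 := LinearMap.congr_fun hgi x
        exact sub_eq_zero.2 h2.symm
      have h2 : φ i - g = ((φ i - g) (0, 1)) • LinearMap.snd ℝ E ℝ := by
        refine LinearMap.ext fun ⟨x, y⟩ => ?_
        have h3 : ((x, y) : E × ℝ) = (x, 0) + y • (0, 1) := by simp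
        rw [h3, map_add, map_smul, h1]
        simp [mul_comm]
      have h3 : (φ i - g) (0, 1) ≠ 0 := fun h0 => by
        rw [h0, zero_smul, sub_eq_zero] at h2
        exact (linearIndepOn_iff_notMem_span.1 (h.mono hTS)) i hi (h2 ▸ hg)
      refine ⟨?_, g, hg, _, eq_add_of_sub_eq' h2⟩
      rw [← Submodule.smul_mem_iff _ h3, ← h2]
      exact Submodule.sub_mem _ (subset_span ⟨i, hi, rfl⟩)
        (span_mono (Set.image_mono Set.sdiff_subset) hg)
    have h1 : ¬ LinearIndepOn ℝ α S := fun h1 => hS (hsolve S h1)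
    rw [linearIndepOn_iff_notMem_span] at h1
    push Not at h1
    obtain ⟨i, hi, hspan⟩ := h1
    obtain ⟨-, g, hg, s, hs⟩ := key S subset_rfl i hi hspan
    have h2 : LinearIndepOn ℝ α (S \ {i}) := by
      by_contra h3
      rw [linearIndepOn_iff_notMem_span] at h3
      push Not at h3
      obtain ⟨j, hj, hspan'⟩ := h3
      have h4 := (key (S \ {i}) Set.sdiff_subset j hj hspan').1
      refine linearIndepOn_iff_notMem_span.1 h i hi ?_
      rw [hs]
      exact Submodule.add_mem _ hg (Submodule.smul_mem _ _ h4)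
    exact ⟨i, hi, hsolve _ h2, h2⟩
  · rintro ⟨i, hi, ⟨x, hx⟩, h⟩
    have h1 := (hcentral _ ⟨x, hx⟩).1 h
    rw [← Set.insert_sdiff_self_of_mem hi]
    refine h1.insert fun hspan => hS ⟨x, fun j hj => ?_⟩
    by_cases hji : j = i
    · subst hji
      have hle : span ℝ (φ '' (S \ {j})) ≤ (Dual.eval ℝ (E × ℝ) (x, 1)).ker := by
        rw [span_le]
        rintro _ ⟨k, hk, rfl⟩
        exact hx k hk
      exact hle hspan
    · exact hx j ⟨hj, hji⟩

end Lift

/-! ### Recovering the matroid from an isomorphism of posets -/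

section Semicone

variable {E : Type*} [AddCommGroup E] [Module ℝ E] {A : Finset (AffineSubspace ℝ E)}

theorem mem_semicone {K : AffineSubspace ℝ (E × ℝ)} :
    K ∈ semicone A ↔ ∃ H ∈ A, homogenize H = K := by
  simp [semicone]

variable [FiniteDimensional ℝ E]

theorem IsHyperplane.mem_homogenize_iff {H : AffineSubspace ℝ E} (hH : IsHyperplane H)
    {z : E × ℝ} : z ∈ homogenize H ↔ equation H z = 0 := by
  rw [homogenize, Submodule.mem_toAffineSubspace, ← LinearMap.mem_ker]
  suffices h : span ℝ ((fun x : E => (x, (1 : ℝ))) '' (H : Set E)) = (equation H).ker by rw [h]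
  refine le_antisymm (span_le.2 ?_) fun ⟨x, y⟩ hxy => ?_
  · rintro _ ⟨x, hx, rfl⟩
    exact hH.mem_iff.1 hx
  have hmem : ∀ x ∈ H, ((x, 1) : E × ℝ) ∈ span ℝ ((fun x : E => (x, (1 : ℝ))) '' (H : Set E)) :=
    fun x hx => subset_span ⟨x, hx, rfl⟩
  rw [LinearMap.mem_ker] at hxy
  by_cases hy : y = 0
  · subst hy
    obtain ⟨w, hw⟩ := hH.1
    have h1 : x + w ∈ H := by
      have h2 : ((x + w, 1) : E × ℝ) = (x, 0) + (w, 1) := by simp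
      rw [hH.mem_iff, h2, map_add, hxy, hH.mem_iff.1 hw, add_zero]
    have h2 : ((x, 0) : E × ℝ) = (x + w, 1) - (w, 1) := by simp
    rw [h2]
    exact Submodule.sub_mem _ (hmem _ h1) (hmem _ hw)
  · have h2 : ((y⁻¹ • x, 1) : E × ℝ) = y⁻¹ • (x, y) := by simp [hy]
    have h1 : y⁻¹ • x ∈ H := by rw [hH.mem_iff, h2, map_smul, hxy, smul_zero]
    have h3 := hmem _ h1
    rw [h2] at h3
    exact (Submodule.smul_mem_iff _ (inv_ne_zero hy)).1 h3

theorem IsHyperplane.homogenize {H : AffineSubspace ℝ E} (hH : IsHyperplane H) :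
    IsHyperplane (homogenize H) := by
  have h1 : HyperplaneArrangement.homogenize H = (equation H).ker.toAffineSubspace := by
    ext z
    rw [hH.mem_homogenize_iff, Submodule.mem_toAffineSubspace, LinearMap.mem_ker]
  have h2 : equation H ≠ 0 := fun h => hH.normal_ne_zero (by rw [normal, h, LinearMap.zero_comp])
  rw [h1]
  refine ⟨⟨0, Submodule.zero_mem _⟩, ?_⟩
  rw [Submodule.toAffineSubspace_direction]
  exact Module.Dual.finrank_ker_add_one_of_ne_zero h2

theorem IsArrangement.semicone (hA : IsArrangement A) : IsArrangement (semicone A) := by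
  intro K hK
  obtain ⟨H, hH, rfl⟩ := mem_semicone.1 hK
  exact (hA H hH).homogenize

/-- The hyperplanes of the semicone correspond to those of the arrangement. -/
theorem exists_equiv_semicone (hA : IsArrangement A) :
    ∃ τ : A ≃ semicone A, ∀ H, (τ H).1 = homogenize H.1 := by
  refine ⟨Equiv.ofBijective
    (fun H => ⟨homogenize H.1, mem_semicone.2 ⟨H.1, H.2, rfl⟩⟩) ⟨fun H H' h => ?_, fun K => ?_⟩,
    fun H => rfl⟩
  · have h1 : homogenize H.1 = homogenize H'.1 := congrArg Subtype.val h
    refine Subtype.ext (AffineSubspace.ext fun x => ?_)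
    rw [(hA _ H.2).mem_iff, (hA _ H'.2).mem_iff, ← (hA _ H.2).mem_homogenize_iff,
      ← (hA _ H'.2).mem_homogenize_iff, h1]
  · obtain ⟨H, hH, hK⟩ := mem_semicone.1 K.2
    exact ⟨⟨H, hH⟩, Subtype.ext hK⟩

variable {F : Type*} [AddCommGroup F] [Module ℝ F] [FiniteDimensional ℝ F]
  {B : Finset (AffineSubspace ℝ F)}

theorem exists_equiv_of_semicone_orderIso (hA : IsArrangement A) (hB : IsArrangement B)
    (e : IntersectionPoset (semicone A) ≃o IntersectionPoset (semicone B)) :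
    ∃ σ : A ≃ B, ∀ S : Set A, LinearIndepOn ℝ (fun H : A => equation H.1) S ↔
      LinearIndepOn ℝ (fun H : A => equation (σ H).1) S := by
  obtain ⟨σ', hσ'⟩ := exists_equiv_hyperplaneElement hA.semicone hB.semicone e
  obtain ⟨τ, hτ⟩ := exists_equiv_semicone hA
  obtain ⟨τ', hτ'⟩ := exists_equiv_semicone hB
  refine ⟨(τ.trans σ').trans τ'.symm, fun S => ?_⟩
  have h1 := irredundant_iff (a := fun H : A => hyperplaneElement hA.semicone (τ H))
    (fun H => (τ H).2) (α := fun H => equation H.1) (c := 0) (fun H x => by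
      rw [Pi.zero_apply, ← (hA _ H.2).mem_homogenize_iff, ← hτ]
      rfl) S
  have h2 := irredundant_iff (a := fun H : A => hyperplaneElement hB.semicone (σ' (τ H)))
    (fun H => (σ' (τ H)).2) (α := fun H => equation (((τ.trans σ').trans τ'.symm) H).1) (c := 0)
    (fun H x => by
      rw [Pi.zero_apply, ← (hB _ (Subtype.prop _)).mem_homogenize_iff, ← hτ']
      simp
      rfl) S
  have h3 : Irredundant (fun H : A => hyperplaneElement hB.semicone (σ' (τ H))) S ↔
      Irredundant (fun H : A => hyperplaneElement hA.semicone (τ H)) S := by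
    simp only [hσ']
    exact irredundant_orderIso_iff e _ S
  rw [h1, h2, and_iff_right ⟨0, by simp⟩, and_iff_right ⟨0, by simp⟩] at h3
  exact h3.symm

theorem exists_equiv_of_orderIso (hA : IsArrangement A) (hB : IsArrangement B)
    (e : IntersectionPoset A ≃o IntersectionPoset B) :
    ∃ σ : A ≃ B, ∀ S : Set A, LinearIndepOn ℝ (fun H : A => equation H.1) S ↔
      LinearIndepOn ℝ (fun H : A => equation (σ H).1) S := by
  obtain ⟨σ, hσ⟩ := exists_equiv_hyperplaneElement hA hB e
  refine ⟨σ, fun S => ?_⟩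
  have hc : ∀ S : Set A, (∃ x, ∀ H ∈ S, equation H.1 (x, 1) = 0) ↔
      ∃ x, ∀ H ∈ S, equation (σ H).1 (x, 1) = 0 := by
    intro S
    have h1 := exists_forall_le_iff_exists_mem (a := fun H : A => hyperplaneElement hA H)
      (fun H => H.2) S
    have h2 := exists_forall_le_iff_exists_mem (a := fun H : A => hyperplaneElement hB (σ H))
      (fun H => (σ H).2) S
    have h3 := exists_forall_apply_le_iff e (fun H : A => hyperplaneElement hA H) S
    simp only [← hσ] at h3
    rw [h1, h2] at h3
    have h4 : ∀ (H : A) x, x ∈ (OrderDual.ofDual (hyperplaneElement hA H)).1 ↔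
        equation H.1 (x, 1) = 0 := fun H x => (hA _ H.2).mem_iff
    have h5 : ∀ (H : A) x, x ∈ (OrderDual.ofDual (hyperplaneElement hB (σ H))).1 ↔
        equation (σ H).1 (x, 1) = 0 := fun H x => (hB _ (σ H).2).mem_iff
    simp only [h4, h5] at h3
    exact h3.symm
  have hI : ∀ S : Set A, ((∃ x, ∀ H ∈ S, equation H.1 (x, 1) = 0) ∧
      LinearIndepOn ℝ (fun H : A => equation H.1 ∘ₗ LinearMap.inl ℝ E ℝ) S) ↔
      ((∃ x, ∀ H ∈ S, equation (σ H).1 (x, 1) = 0) ∧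
      LinearIndepOn ℝ (fun H : A => equation (σ H).1 ∘ₗ LinearMap.inl ℝ F ℝ) S) := by
    intro S
    have h1 := irredundant_iff (a := fun H : A => hyperplaneElement hA H) (fun H => H.2)
      (α := fun H => normal H.1) (c := fun H => -equation H.1 (0, 1)) (fun H x => by
        rw [← add_eq_zero_iff_eq_neg, ← one_mul (equation H.1 (0, 1)), ← equation_apply]
        exact (hA _ H.2).mem_iff) S
    have h2 := irredundant_iff (a := fun H : A => hyperplaneElement hB (σ H))
      (fun H => (σ H).2)
      (α := fun H => normal (σ H).1) (c := fun H => -equation (σ H).1 (0, 1)) (fun H x => by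
        rw [← add_eq_zero_iff_eq_neg, ← one_mul (equation (σ H).1 (0, 1)), ← equation_apply]
        exact (hB _ (σ H).2).mem_iff) S
    have h3 : Irredundant (fun H : A => hyperplaneElement hB (σ H)) S ↔
        Irredundant (fun H : A => hyperplaneElement hA H) S := by
      simp only [hσ]
      exact irredundant_orderIso_iff e _ S
    rw [h1, h2] at h3
    simp only [← add_eq_zero_iff_eq_neg] at h3
    have h4 : ∀ (H : A) x, normal H.1 x + equation H.1 (0, 1) = equation H.1 (x, 1) :=
      fun H x => by rw [equation_apply H.1 x, one_mul]
    have h5 : ∀ (H : A) x, normal (σ H).1 x + equation (σ H).1 (0, 1) = equation (σ H).1 (x, 1) :=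
      fun H x => by rw [equation_apply (σ H).1 x, one_mul]
    simp only [h4, h5] at h3
    exact h3.symm
  rw [linearIndepOn_iff_of_equations, linearIndepOn_iff_of_equations]
  exact or_congr (hI S) (and_congr (not_congr (hc S))
    (exists_congr fun H => and_congr_right fun _ => hI _))

end Semicone


/-! ### Invariance of the valid order arrangement -/

theorem centralArrangement_comp_equiv {ι κ V : Type*} [Fintype ι] [Fintype κ] [AddCommGroup V]
    [Module ℝ V] (f : ι → Dual ℝ V) (σ : κ ≃ ι) (p : V) :
    centralArrangement (f ∘ σ) p = centralArrangement f p := by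
  ext X
  simp [centralArrangement, σ.surjective.exists]

/-- A polynomial whose nonvanishing at `p`, for `p` on no hyperplane of `A`, makes the matroid of
the valid order arrangement the Dilworth truncation of the matroid of the equations of `A`. -/
noncomputable def genericPolynomial {d : ℕ} (A : Finset (AffineSubspace ℝ (Fin d → ℝ))) :
    MvPolynomial (Fin d) ℝ :=
  (exists_polynomial_forall_linearIndepOn_crossing fun H : A => equation H.1).choose

theorem genericPolynomial_ne_zero {d : ℕ} (A : Finset (AffineSubspace ℝ (Fin d → ℝ))) :
    genericPolynomial A ≠ 0 :=
  (exists_polynomial_forall_linearIndepOn_crossing fun H : A => equation H.1).choose_spec.1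

theorem linearIndepOn_voForm_iff_dilworthIndep {d : ℕ} {A : Finset (AffineSubspace ℝ (Fin d → ℝ))}
    (hA : IsArrangement A) {p : Fin d → ℝ} (hp : ∀ H ∈ A, p ∉ H)
    (hg : MvPolynomial.eval p (genericPolynomial A) ≠ 0) (T : Set (OffDiag A)) :
    LinearIndepOn ℝ (voForm A p) T ↔ DilworthIndep (fun H : A => equation H.1) T := by
  have hp' : ∀ H : A, equation H.1 (p, 1) ≠ 0 := fun H h =>
    hp H.1 H.2 ((hA H.1 H.2).mem_iff.2 h)
  rw [linearIndepOn_voForm_iff hp']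
  exact (exists_polynomial_forall_linearIndepOn_crossing
    fun H : A => equation H.1).choose_spec.2 p hg hp' T

theorem exists_equiv_linearIndepOn_equation_iff {E F : Type*} [AddCommGroup E] [Module ℝ E]
    [FiniteDimensional ℝ E] [AddCommGroup F] [Module ℝ F] [FiniteDimensional ℝ F]
    {A : Finset (AffineSubspace ℝ E)} {B : Finset (AffineSubspace ℝ F)} (hA : IsArrangement A)
    (hB : IsArrangement B)
    (h : Nonempty (IntersectionPoset A ≃o IntersectionPoset B) ∨
      Nonempty (IntersectionPoset (semicone A) ≃o IntersectionPoset (semicone B))) :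
    ∃ σ : A ≃ B, ∀ S : Set A, LinearIndepOn ℝ (fun H : A => equation H.1) S ↔
      LinearIndepOn ℝ (fun H : A => equation (σ H).1) S := by
  rcases h with ⟨⟨e⟩⟩ | ⟨⟨e⟩⟩
  · exact exists_equiv_of_orderIso hA hB e
  · exact exists_equiv_of_semicone_orderIso hA hB e

theorem vo_invariants_eq {d e : ℕ} {A : Finset (AffineSubspace ℝ (Fin d → ℝ))}
    {B : Finset (AffineSubspace ℝ (Fin e → ℝ))} (hd : 0 < d) (he : 0 < e) (hA : IsArrangement A)
    (hB : IsArrangement B)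
    (h : Nonempty (IntersectionPoset A ≃o IntersectionPoset B) ∨
      Nonempty (IntersectionPoset (semicone A) ≃o IntersectionPoset (semicone B)))
    {p : Fin d → ℝ} {q : Fin e → ℝ} (hp : ∀ H ∈ A, p ∉ H)
    (hpg : MvPolynomial.eval p (genericPolynomial A) ≠ 0) (hq : ∀ H ∈ B, q ∉ H)
    (hqg : MvPolynomial.eval q (genericPolynomial B) ≠ 0) :
    X ^ e * charPoly (vo A p) = X ^ d * charPoly (vo B q) ∧
      numValidOrderings A p = numValidOrderings B q := by
  classical
  obtain ⟨σ, hσ⟩ := exists_equiv_linearIndepOn_equation_iff hA hB h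
  have hindep : ∀ T : Set (OffDiag A), LinearIndepOn ℝ (voForm A p) T ↔
      LinearIndepOn ℝ (voForm B q ∘ offDiagCongr σ) T := fun T => by
    rw [linearIndepOn_equiv, linearIndepOn_voForm_iff_dilworthIndep hA hp hpg,
      linearIndepOn_voForm_iff_dilworthIndep hB hq hqg, dilworthIndep_image_iff]
    exact dilworthIndep_congr hσ T
  have := Fin.pos_iff_nonempty.1 hd
  have := Fin.pos_iff_nonempty.1 he
  constructor
  · have key := charPoly_centralArrangement_congr hindep p q
    rwa [centralArrangement_comp_equiv, ← vo_eq_centralArrangement hA hp,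
      ← vo_eq_centralArrangement hB hq, finrank_fin_fun, finrank_fin_fun] at key
  · rw [numValidOrderings_eq_ncard_signPatterns hA hp,
      numValidOrderings_eq_ncard_signPatterns hB hq,
      ← ncard_signPatterns_univ_comp (voForm B q) (offDiagCongr σ)]
    exact ncard_signPatterns_congr _ _ _ fun T _ => hindep T

end HyperplaneArrangement

open HyperplaneArrangement in
theorem mainTheorem4 :
    ∃ g : (d : ℕ) → Finset (AffineSubspace ℝ (Fin d → ℝ)) → MvPolynomial (Fin d) ℝ,
      (∀ (d : ℕ) (A : Finset (AffineSubspace ℝ (Fin d → ℝ))), g d A ≠ 0) ∧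
      (∀ (d e : ℕ) (A : Finset (AffineSubspace ℝ (Fin d → ℝ)))
          (B : Finset (AffineSubspace ℝ (Fin e → ℝ))),
        0 < d → 0 < e → IsArrangement A → IsArrangement B →
        (Nonempty (IntersectionPoset A ≃o IntersectionPoset B) ∨
          Nonempty (IntersectionPoset (semicone A) ≃o IntersectionPoset (semicone B))) →
        ∀ (p : Fin d → ℝ) (q : Fin e → ℝ),
          (∀ H ∈ A, p ∉ H) → MvPolynomial.eval p (g d A) ≠ 0 →
          (∀ H ∈ B, q ∉ H) → MvPolynomial.eval q (g e B) ≠ 0 →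
          (d = e → charPoly (vo A p) = charPoly (vo B q)) ∧
          Polynomial.X ^ e * charPoly (vo A p) = Polynomial.X ^ d * charPoly (vo B q) ∧
          numValidOrderings A p = numValidOrderings B q) ∧
      (∀ (d : ℕ) (A : Finset (AffineSubspace ℝ (Fin d → ℝ))),
        0 < d → IsArrangement A →
        ∀ p p' : Fin d → ℝ,
          (∀ H ∈ A, p ∉ H) → MvPolynomial.eval p (g d A) ≠ 0 →
          (∀ H ∈ A, p' ∉ H) → MvPolynomial.eval p' (g d A) ≠ 0 →
          numValidOrderings A p = numValidOrderings A p') := by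
  refine ⟨fun _ A => genericPolynomial A, fun _ A => genericPolynomial_ne_zero A, ?_, ?_⟩
  · intro d e A B hd he hA hB h p q hp hpg hq hqg
    have key := vo_invariants_eq hd he hA hB h hp hpg hq hqg
    refine ⟨fun hde => ?_, key⟩
    subst hde
    exact mul_left_cancel₀ (pow_ne_zero d Polynomial.X_ne_zero) key.1
  · intro d A hd hA p p' hp hpg hp' hpg'
    exact (vo_invariants_eq hd hd hA hA (Or.inl ⟨OrderIso.refl _⟩) hp hpg hp' hpg').2
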